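/- **Setting.** Consider the single-input single-output feedback loop $e=r-y$, $q=Ke$, $u=\mathcal R q$, $y=Gu$, where $K,G$ are finite-dimensional real linear time-invariant systems and $\mathcal R$ is a reset controller: $\dot x=A_Rx+B_Rq$, $u=C_Rx+D_Rq$, and at the reset instants $t_R=\{t: q(t)=0\}$, which are finitely many in bounded time, the state jumps, $x(t^+)=A_\rho x(t)$. Signals are defined on all of $\mathbb R$, and the value of a signal at a reset instant is the one just before the reset. Let $R_L(s)=C_R(sI-A_R)^{-1}B_R+D_R$, $R_\delta(s)=C_R(sI-A_R)^{-1}(A_\rho-I)$, $S_L=(1+GR_LK)^{-1}$, and $Q_\delta=K\,S_L\,G\,R_\delta$. The loop without resets is the base linear system (BLS); it is assumed well-posed and asymptotically stable. Let $(A_Q,B_Q,C_Q,D_Q)$ be any state-space realization of $Q_\delta$ with all eigenvalues of $A_Q$ in the open left half-plane. The reference is $r(t)=|R_I|\sin(\omega t+\angle R_I)$ with $\omega>0$ and phasor $R_I\in\mathbb C$, where $j\omega$ is not an eigenvalue of the state matrices of $K$, $\mathcal R$, $G$. Assume that the reset control system has a unique $2\pi/\omega$-periodic response (its steady state), to which $q$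 and $x$ refer below, and let $q_L$ be the signal $q$ in the $2\pi/\omega$-periodic response of the BLS. Assume further: 1. (Two resets per period) every interval $[a,a+2\pi/\omega)$ contains exactly two reset instants; 2. (Zero crossing direction) $\operatorname{sign}\dot q(t)=\operatorname{sign}\dot q_L(t)$ whenever $q(t)=0$, where $\dot q$ is the left derivative; 3. (Existence of a reset instant) at every $t\in t_R$, $\bigl|\sum_{\tau\in t_R,\ \tau<t}C_Qe^{A_Q(t-\tau)}B_Q\,x(\tau)\bigr|<\sup_{t'}|q_L(t')|$. Call $t\in t_R$ *descending* if $\dot q(t)<0$. Write $Z=K(j\omega)S_L(j\omega)R_I$, with principal argument $\angle Z\in(-\pi,\pi]$, and $$\Phi(\omega,x)=\arcsin\Bigl(C_Q\sum_{p\in\{2,4,6,\dots\}}\bigl(e^{A_Qp\pi/\omega}-e^{A_Q(p-1)\pi/\omega}\bigr)B_Q\,x\;|Z|^{-1}\Bigr).$$ **Claim.** The matrix series converges, and there is exactly one descending reset instant $t_\rho^\downarrow$ with $$\omega t_\rho^\downarrow+\angle Z+\Phi(\omega,x(t_\rho^\downarrow))=\pi .$$ For every descending reset instant $t$: - $|Z|>0$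 and the argument of the arcsine at $x=x(t)$ lies in $(-1,1)$; - $\omega t+\angle Z+\Phi(\omega,x(t))\in\pi+2\pi\mathbb Z$; - the reset instants are exactly the zeros of the sinusoid $Q^\star(t')=\sin(\omega t'+\angle Q^\star)$ with phase $\angle Q^\star=\angle Z+\Phi(\omega,x(t))$, they are exactly the times $t+p\pi/\omega$, $p\in\mathbb Z$, and the descending ones are exactly the descending zero crossings of $Q^\star$; - if $\Phi(\omega,x(t))=0$, the descending reset instants are exactly the descending zero crossings of $q_L$. -/

import Mathlib

open scoped Topology Matrix

noncomputable section

namespace ResetLoop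

/-- The complex matrix `s I - A` of a real square matrix `A`. -/
def charMat {n : Type*} [DecidableEq n] (A : Matrix n n ℝ) (s : ℂ) : Matrix n n ℂ :=
  s • (1 : Matrix n n ℂ) - A.map (fun a => (a : ℂ))

/-- `s` is an eigenvalue of the real matrix `A`. -/
def IsEig {n : Type*} [Fintype n] [DecidableEq n] (A : Matrix n n ℝ) (s : ℂ) : Prop :=
  (charMat A s).det = 0

/-- All eigenvalues lie in the open left half plane (asymptotic stability). -/
def IsHurwitz {n : Type*} [Fintype n] [DecidableEq n] (A : Matrix n n ℝ) : Prop :=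
  ∀ s : ℂ, IsEig A s → s.re < 0

/-- A single-input single-output state-space system
`x' = A x + B v`, `w = C x + D v`. -/
structure SISO (n : Type*) where
  A : Matrix n n ℝ
  B : n → ℝ
  C : n → ℝ
  D : ℝ

/-- Transfer function `C (sI - A)⁻¹ B + D`. -/
def SISO.transfer {n : Type*} [Fintype n] [DecidableEq n] (S : SISO n) (s : ℂ) : ℂ :=
  (fun i => (S.C i : ℂ)) ⬝ᵥ ((charMat S.A s)⁻¹ *ᵥ (fun i => (S.B i : ℂ))) + (S.D : ℂ)

/-- Series connection: the output of `S₁` is the input of `S₂`. -/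
def SISO.series {n₁ n₂ : Type*} (S₁ : SISO n₁) (S₂ : SISO n₂) : SISO (n₁ ⊕ n₂) where
  A := Matrix.fromBlocks S₁.A 0 (Matrix.vecMulVec S₂.B S₁.C) S₂.A
  B := Sum.elim S₁.B (S₁.D • S₂.B)
  C := Sum.elim (S₂.D • S₁.C) S₂.C
  D := S₂.D * S₁.D

/-- State matrix of the unity negative feedback loop around `S`. -/
def SISO.feedbackMatrix {n : Type*} (S : SISO n) : Matrix n n ℝ :=
  S.A - (1 + S.D)⁻¹ • Matrix.vecMulVec S.B S.C

/-- A state-space system with input space indexed by `m` and a scalar output. -/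
structure MISO (n m : Type*) where
  A : Matrix n n ℝ
  B : Matrix n m ℝ
  C : n → ℝ
  D : m → ℝ

/-- Transfer function `C (sI - A)⁻¹ B + D`, a row vector. -/
def MISO.transfer {n m : Type*} [Fintype n] [DecidableEq n] (S : MISO n m) (s : ℂ) : m → ℂ :=
  (fun i => (S.C i : ℂ)) ᵥ* ((charMat S.A s)⁻¹ * S.B.map (fun b => (b : ℂ)))
    + (fun i => (S.D i : ℂ))

/-- Response at time `τ > 0` after an impulse with weight `v` at time `0`:
`C exp(A τ) B v`. -/
def MISO.impulse {n m : Type*} [Fintype n] [DecidableEq n] [Fintype m]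
    (S : MISO n m) (τ : ℝ) (v : m → ℝ) : ℝ :=
  S.C ⬝ᵥ (NormedSpace.exp (τ • S.A) *ᵥ (S.B *ᵥ v))

/-- A reset controller: a linear system (its base linear system) and a reset matrix `Aρ`.
When the input vanishes, the state jumps from `x` to `Aρ x`. -/
structure ResetController (n : Type*) extends SISO n where
  Aρ : Matrix n n ℝ

/-- `R_δ(s) = C_R (sI - A_R)⁻¹ (A_ρ - I)`, the transfer function (a row vector) from state impulses
of weight `x(t_r)` at the reset instants to the output of the reset controller. -/
def ResetController.Rδ {n : Type*} [Fintype n] [DecidableEq n] (R : ResetController n) (s : ℂ) :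
    n → ℂ :=
  (fun i => (R.C i : ℂ)) ᵥ* ((charMat R.A s)⁻¹ * (R.Aρ - 1).map (fun a => (a : ℂ)))

/-- The loop: `e = r - y`, `K` maps `e` to `q`, the reset controller `R` maps `q` to `u`,
`G` maps `u` to `y`. -/
structure Loop (nK nR nG : Type*) where
  K : SISO nK
  R : ResetController nR
  G : SISO nG

section Loop

variable {nK nR nG : Type*}

/-- The base linear open loop: `K`, then `R` without resets, then `G`. -/
def Loop.openLoop (P : Loop nK nR nG) : SISO ((nK ⊕ nR) ⊕ nG) :=
  (P.K.series P.R.toSISO).series P.G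

/-- The algebraic loop `e = r - y` can be solved. -/
def Loop.WellPosed (P : Loop nK nR nG) : Prop := 1 + P.openLoop.D ≠ 0

variable [Fintype nK] [DecidableEq nK] [Fintype nR] [DecidableEq nR] [Fintype nG] [DecidableEq nG]

/-- The base linear system (the closed loop without resets) is asymptotically stable. -/
def Loop.BLSStable (P : Loop nK nR nG) : Prop := IsHurwitz P.openLoop.feedbackMatrix

/-- `s` is no open-loop pole, so that `K(s)`, `R_L(s)`, `R_δ(s)` and `G(s)` are all defined. -/
def Loop.NoPoleAt (P : Loop nK nR nG) (s : ℂ) : Prop :=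
  ¬ IsEig P.K.A s ∧ ¬ IsEig P.R.A s ∧ ¬ IsEig P.G.A s

/-- `L(s) = G(s) R_L(s) K(s)`. -/
def Loop.L (P : Loop nK nR nG) (s : ℂ) : ℂ :=
  P.G.transfer s * P.R.toSISO.transfer s * P.K.transfer s

/-- The base linear sensitivity `S_L(s) = (1 + L(s))⁻¹`. -/
def Loop.SL (P : Loop nK nR nG) (s : ℂ) : ℂ := (1 + P.L s)⁻¹

/-- `Q_δ(s) = K(s) S_L(s) G(s) R_δ(s)`. -/
def Loop.Qδ (P : Loop nK nR nG) (s : ℂ) : nR → ℂ :=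
  (P.K.transfer s * P.SL s * P.G.transfer s) • P.R.Rδ s

/-- `S` is a state-space realization of `Q_δ`: the transfer functions agree at every point where
both expressions are defined. -/
def Loop.IsRealizationQδ {nQ : Type*} [Fintype nQ] [DecidableEq nQ]
    (P : Loop nK nR nG) (S : MISO nQ nR) : Prop :=
  ∀ s : ℂ, P.NoPoleAt s → 1 + P.L s ≠ 0 → ¬ IsEig S.A s → S.transfer s = P.Qδ s

end Loop

/-- The time signals of the loop: states of `K`, `R`, `G`, and the scalar signals. The value at a
reset instant is the value just before the reset. -/
@[ext]
structure Signals (nK nR nG : Type*) where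
  xK : ℝ → nK → ℝ
  xR : ℝ → nR → ℝ
  xG : ℝ → nG → ℝ
  e : ℝ → ℝ
  q : ℝ → ℝ
  u : ℝ → ℝ
  y : ℝ → ℝ

section Signals

variable {nK nR nG : Type*}

/-- All signals have period `c`. -/
structure Signals.IsPeriodic (σ : Signals nK nR nG) (c : ℝ) : Prop where
  xK : Function.Periodic σ.xK c
  xR : Function.Periodic σ.xR c
  xG : Function.Periodic σ.xG c
  e : Function.Periodic σ.e c
  q : Function.Periodic σ.q c
  u : Function.Periodic σ.u c
  y : Function.Periodic σ.y c

/-- The reset instants `t_R` prescribed by the zero-crossing law. -/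
def Signals.resets (σ : Signals nK nR nG) : Set ℝ := {t | σ.q t = 0}

/-- A reset instant at a descending zero crossing of `q`. Resets may make `q` non-smooth to
the right, hence the left derivative. -/
def Signals.IsDescendingReset (σ : Signals nK nR nG) (t : ℝ) : Prop :=
  t ∈ σ.resets ∧ derivWithin σ.q (Set.Iic t) t < 0

variable [Fintype nK] [Fintype nR] [Fintype nG]

/-- The signals `σ`, on the whole time axis, obey the loop equations with reference `r` when the
state of `R` is reset exactly at the instants in `T`. -/
structure Loop.IsResponse (P : Loop nK nR nG) (r : ℝ → ℝ) (T : Set ℝ)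
    (σ : Signals nK nR nG) : Prop where
  error : ∀ t, σ.e t = r t - σ.y t
  outK : ∀ t, σ.q t = P.K.C ⬝ᵥ σ.xK t + P.K.D * σ.e t
  outR : ∀ t, σ.u t = P.R.C ⬝ᵥ σ.xR t + P.R.D * σ.q t
  outG : ∀ t, σ.y t = P.G.C ⬝ᵥ σ.xG t + P.G.D * σ.u t
  flowK : ∀ t, t ∉ T → HasDerivAt σ.xK (P.K.A *ᵥ σ.xK t + σ.e t • P.K.B) t
  flowR : ∀ t, t ∉ T → HasDerivAt σ.xR (P.R.A *ᵥ σ.xR t + σ.q t • P.R.B) t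
  flowG : ∀ t, t ∉ T → HasDerivAt σ.xG (P.G.A *ᵥ σ.xG t + σ.u t • P.G.B) t
  contK : ∀ t ∈ T, ContinuousAt σ.xK t
  contG : ∀ t ∈ T, ContinuousAt σ.xG t
  leftR : ∀ t ∈ T, Filter.Tendsto σ.xR (𝓝[<] t) (𝓝 (σ.xR t))
  jumpR : ∀ t ∈ T, Filter.Tendsto σ.xR (𝓝[>] t) (𝓝 (P.R.Aρ *ᵥ σ.xR t))

/-- Response of the reset control system: resets take place exactly when `q` vanishes, and there
are only finitely many of them in bounded time. -/
def Loop.IsResetResponse (P : Loop nK nR nG) (r : ℝ → ℝ) (σ : Signals nK nR nG) : Prop :=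
  P.IsResponse r σ.resets σ ∧ ∀ a b : ℝ, (σ.resets ∩ Set.Icc a b).Finite

/-- Steady-state response of the reset control system to a reference of period `c`:
its only response of period `c`. -/
def Loop.IsSteadyState (P : Loop nK nR nG) (r : ℝ → ℝ) (c : ℝ) (σ : Signals nK nR nG) : Prop :=
  (P.IsResetResponse r σ ∧ σ.IsPeriodic c) ∧
    ∀ σ' : Signals nK nR nG, P.IsResetResponse r σ' → σ'.IsPeriodic c → σ' = σ

/-- Steady-state response of the base linear system (no resets). -/
def Loop.IsBLSSteadyState (P : Loop nK nR nG) (r : ℝ → ℝ) (c : ℝ) (σ : Signals nK nR nG) :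
    Prop :=
  P.IsResponse r ∅ σ ∧ σ.IsPeriodic c

end Signals

/-- The sinusoid `|z| sin(ω t + ∠z)` with phasor `z`. -/
def sinusoid (ω : ℝ) (z : ℂ) (t : ℝ) : ℝ := ‖z‖ * Real.sin (ω * t + z.arg)

section Phase

variable {nK nR nG nQ : Type*} [Fintype nK] [DecidableEq nK] [Fintype nR] [DecidableEq nR]
  [Fintype nG] [DecidableEq nG] [Fintype nQ] [DecidableEq nQ]

/-- Exactly two resets in each period `2π/ω`. -/
def TwoResetsPerPeriod (ω : ℝ) (σ : Signals nK nR nG) : Prop :=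
  ∀ a : ℝ, (σ.resets ∩ Set.Ico a (a + 2 * Real.pi / ω)).ncard = 2

/-- Whenever `q` crosses zero, it does so in the direction of the base linear signal `q_L`. -/
def SameCrossingDirection (σ σL : Signals nK nR nG) : Prop :=
  ∀ t : ℝ, σ.q t = 0 →
    SignType.sign (derivWithin σ.q (Set.Iic t) t) = SignType.sign (deriv σL.q t)

/-- At every reset instant the summed impulse responses of all earlier resets are smaller in
absolute value than the peak value of `|q_L|`. -/
def PriorResetsBelowPeak (S : MISO nQ nR) (σ σL : Signals nK nR nG) : Prop :=
  ∀ t ∈ σ.resets, ∃ t' : ℝ,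
    |∑' τ : {τ : ℝ // τ ∈ σ.resets ∧ τ < t}, S.impulse (t - τ) (σ.xR τ)| < |σL.q t'|

/-- The term of index `p = 2(k+1)` in the series over the positive even integers:
`exp(A_Q p π/ω) - exp(A_Q (p-1) π/ω)`. -/
def seriesTerm (S : MISO nQ nR) (ω : ℝ) (k : ℕ) : Matrix nQ nQ ℝ :=
  NormedSpace.exp (((2 * ((k : ℝ) + 1)) * Real.pi / ω) • S.A)
    - NormedSpace.exp (((2 * ((k : ℝ) + 1) - 1) * Real.pi / ω) • S.A)

/-- The phasor `K(jω) S_L(jω) R_I(jω)`. -/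
def Loop.phasor (P : Loop nK nR nG) (ω : ℝ) (RI : ℂ) : ℂ :=
  P.K.transfer (ω * Complex.I) * P.SL (ω * Complex.I) * RI

/-- The argument of the inverse sine in `Φ`. -/
def Loop.phaseArg (P : Loop nK nR nG) (S : MISO nQ nR) (ω : ℝ) (RI : ℂ) (x : nR → ℝ) : ℝ :=
  (S.C ⬝ᵥ ((∑' k : ℕ, seriesTerm S ω k) *ᵥ (S.B *ᵥ x))) * ‖P.phasor ω RI‖⁻¹

/-- The phase shift `Φ(ω, x)`. -/
def Loop.Φ (P : Loop nK nR nG) (S : MISO nQ nR) (ω : ℝ) (RI : ℂ) (x : nR → ℝ) : ℝ :=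
  Real.arcsin (P.phaseArg S ω RI x)

/-- The phase of `Q*`: `∠(K(jω) S_L(jω) R_I(jω)) + Φ(ω, x)`. -/
def Loop.phaseQstar (P : Loop nK nR nG) (S : MISO nQ nR) (ω : ℝ) (RI : ℂ) (x : nR → ℝ) : ℝ :=
  (P.phasor ω RI).arg + P.Φ S ω RI x

/-- The unit sinusoid `Q*` in the time domain. -/
def Loop.Qstar (P : Loop nK nR nG) (S : MISO nQ nR) (ω : ℝ) (RI : ℂ) (x : nR → ℝ) (t : ℝ) : ℝ :=
  Real.sin (ω * t + P.phaseQstar S ω RI x)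

end Phase

end ResetLoop

end

noncomputable section

namespace ResetLoop

open NormedSpace Filter

/-! ### Powers of `exp (h A)` for a Hurwitz matrix `A`. -/

section
open scoped Matrix.Norms.Operator

/-! Put h = π/ω. The reference changes sign under a shift by h, and the loop, its reset law
included, is invariant under a simultaneous sign change of all signals. The negated shift of the
steady state is therefore again a periodic response, and uniqueness gives σ(t + h) = -σ(t)
(`Loop.IsSteadyState.negShift_eq`). Together with two resets per period this forces the reset
instants to form one lattice t + hℤ, along which the controller state only alternates in sign
(`resets_eq`).

Let Δ be the loop state minus the base linear steady state. Between resets Δ' = A Δ with A the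
Hurwitz closed-loop matrix, and the reset at t - h adds -b, where b is the jump at t. By half-wave
symmetry Δ(t) = -exp(hA)(Δ(t) + b), whose solution is an alternating geometric series in exp(hA)
(`IsHurwitz.hasSum_alternating`). Since q vanishes at a reset, reading off the output q gives q_L(t)
as an alternating sum of closed-loop impulse responses (`hasSum_impulse_eq_qL`). These are the
impulse responses of any realization of Q_δ, because equal transfer functions have equal Markov
parameters (`Loop.rowQ_exp_eq`). Summing in pairs yields the series in Φ (`hasSum_impulse`).

On the other hand q_L(t) = |Z| sin(ωt + ∠Z) (`Loop.IsBLSSteadyState.exists_phasor`). So sin(ωt + ∠Z)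
equals the argument of the arcsine at every reset (`sin_eq_phaseArg`), and the third assumption
bounds it strictly by 1. The direction assumption says that a reset is descending exactly when
cos(ωt + ∠Z) < 0, and on that branch θ + arcsin(sin θ) is π modulo 2π (`exists_add_arcsin_eq`).
Descending resets are 2π/ω apart and share the same controller state, so exactly one of them attains
the value π itself. -/

theorem hasSum_matrix_exp {𝕜 n : Type*} [RCLike 𝕜] [Fintype n] [DecidableEq n]
    (A : Matrix n n 𝕜) : HasSum (fun k : ℕ => ((k.factorial : 𝕜)⁻¹) • A ^ k) (exp A) :=
  NormedSpace.exp_series_hasSum_exp' A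

theorem hasDerivAt_matrix_exp {n : Type*} [Fintype n] [DecidableEq n]
    (A : Matrix n n ℝ) (t : ℝ) :
    HasDerivAt (fun u : ℝ => exp (u • A)) (exp (t • A) * A) t :=
  hasDerivAt_exp_smul_const A t

/-- By Gelfand's formula the norms of the powers are eventually dominated by a geometric sequence
with ratio strictly between the spectral radius and 1. -/
theorem summable_pow_of_spectrum_lt {n : Type*} [Fintype n] [DecidableEq n]
    (M : Matrix n n ℂ) (hM : ∀ z ∈ spectrum ℂ M, ‖z‖ < 1) : Summable (fun k : ℕ => M ^ k) := by
  cases isEmpty_or_nonempty n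
  · have : ∀ k, M ^ k = 0 := fun k => Subsingleton.elim _ _
    simp [this, summable_zero]
  have h1 : spectralRadius ℂ M < ((1 : NNReal) : ENNReal) :=
    spectrum.spectralRadius_lt_of_forall_lt M fun z hz => by
      simpa [← NNReal.coe_lt_coe] using hM z hz
  obtain ⟨r, hr, hr1⟩ := ENNReal.lt_iff_exists_nnreal_btwn.mp h1
  have hr1' : (r : ℝ) < 1 := by exact_mod_cast hr1
  have hev := (spectrum.pow_nnnorm_pow_one_div_tendsto_nhds_spectralRadius M).eventually_lt_const hr
  refine Summable.of_norm_bounded_eventually_nat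
    (summable_geometric_of_lt_one r.coe_nonneg hr1') ?_
  filter_upwards [hev, Filter.eventually_gt_atTop 0] with k hk hk0
  have hk1 : (0 : ℝ) < k := by exact_mod_cast hk0
  have := ENNReal.rpow_lt_rpow hk hk1
  rw [← ENNReal.rpow_mul, one_div, inv_mul_cancel₀ hk1.ne', ENNReal.rpow_one,
    ENNReal.rpow_natCast] at this
  exact_mod_cast this.le
end

theorem exp_mulVec_eigenvector {n : Type*} [Fintype n] [DecidableEq n]
    {A : Matrix n n ℂ} {v : n → ℂ} {μ : ℂ} (h : A *ᵥ v = μ • v) :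
    exp A *ᵥ v = Complex.exp μ • v := by
  have hpow : ∀ k : ℕ, (A ^ k) *ᵥ v = μ ^ k • v := by
    intro k
    induction k with
    | zero => simp
    | succ k ih => rw [pow_succ, ← Matrix.mulVec_mulVec, h, Matrix.mulVec_smul, ih, smul_smul,
      pow_succ']
  have h1 := (hasSum_matrix_exp A).map (Matrix.mulVecBilin ℂ ℂ |>.flip v)
    (by exact Continuous.matrix_mulVec continuous_id continuous_const)
  have h2 := (NormedSpace.exp_series_hasSum_exp' (𝕂 := ℂ) μ).smul_const v
  rw [← Complex.exp_eq_exp_ℂ] at h2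
  refine h1.unique ?_
  convert h2 using 2 with k
  simp [hpow, smul_smul]

theorem mapMatrix_exp {n : Type*} [Fintype n] [DecidableEq n] (A : Matrix n n ℝ) :
    (exp A).map (fun a => (a : ℂ)) = exp (A.map (fun a => (a : ℂ))) := by
  have h1 := (hasSum_matrix_exp A).map (Complex.ofRealHom.mapMatrix (m := n))
    (Continuous.matrix_map continuous_id Complex.continuous_ofReal)
  refine h1.unique ?_
  convert hasSum_matrix_exp (A.map (fun a => (a : ℂ))) using 2 with k
  have := map_pow (Complex.ofRealHom.mapMatrix (m := n)) A k
  simp only [RingHom.mapMatrix_apply] at this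
  ext i j
  have h2 := congrFun (congrFun this i) j
  simp only [Matrix.map_apply, Complex.ofRealHom_eq_coe] at h2
  simp only [Function.comp, RingHom.mapMatrix_apply, Matrix.map_apply, Matrix.smul_apply,
    smul_eq_mul, map_mul, Complex.ofRealHom_eq_coe]
  rw [h2]
  simp only [Complex.ofReal_inv, Complex.ofReal_natCast]
  rfl

theorem charMat_mulVec {n : Type*} [Fintype n] [DecidableEq n] (A : Matrix n n ℝ) (s : ℂ)
    (v : n → ℂ) : charMat A s *ᵥ v = s • v - A.map (fun a => (a : ℂ)) *ᵥ v := by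
  simp [charMat, Matrix.sub_mulVec, Matrix.smul_mulVec]

/-- The spectral radius of `exp (h A)` is below one if `A` is Hurwitz and `h > 0`. -/
theorem IsHurwitz.norm_lt_one {n : Type*} [Fintype n] [DecidableEq n]
    {A : Matrix n n ℝ} (hA : IsHurwitz A) {h : ℝ} (hh : 0 < h) (z : ℂ)
    (hz : z ∈ spectrum ℂ ((exp (h • A)).map (fun a => (a : ℂ)))) : ‖z‖ < 1 := by
  set Ac : Matrix n n ℂ := A.map (fun a => (a : ℂ)) with hAc
  have hM : (exp (h • A)).map (fun a => (a : ℂ)) = exp ((h : ℂ) • Ac) := by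
    rw [mapMatrix_exp]
    congr 1
    ext i j
    simp [hAc]
  rw [hM, ← Matrix.spectrum_toLin', ← Module.End.hasEigenvalue_iff_mem_spectrum] at hz
  set f := Matrix.toLin' (exp ((h : ℂ) • Ac)) with hf
  set g := Matrix.toLin' Ac with hg
  have hcomm : Commute f g := by
    have : Commute (exp ((h : ℂ) • Ac)) Ac := ((Commute.refl Ac).smul_left (h : ℂ)).exp_left
    have h2 := congrArg Matrix.toLin' this.eq
    rw [Matrix.toLin'_mul, Matrix.toLin'_mul] at h2
    exact h2
  -- Only one direction of spectral mapping is needed: the eigenspace of `exp (h A)` for `z` is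
  -- invariant under `A`, hence contains an eigenvector of `A` with some eigenvalue `μ`, and then `z
  -- = exp (h μ)`.
  have hmaps : Set.MapsTo g (Module.End.eigenspace f z) (Module.End.eigenspace f z) :=
    Module.End.mapsTo_genEigenspace_of_comm hcomm z 1
  have : Nontrivial (Module.End.eigenspace f z) := Submodule.nontrivial_iff_ne_bot.mpr hz
  obtain ⟨μ, hμ⟩ := Module.End.exists_eigenvalue (g.restrict hmaps)
  obtain ⟨w, hw⟩ := hμ.exists_hasEigenvector
  have hw0 : (w : n → ℂ) ≠ 0 := fun h0 => hw.2 (Subtype.ext h0)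
  have hw1 : Ac *ᵥ (w : n → ℂ) = μ • (w : n → ℂ) := by
    have := congrArg Subtype.val hw.apply_eq_smul
    simpa [hg] using this
  have hre : μ.re < 0 := by
    refine hA μ (Matrix.exists_mulVec_eq_zero_iff.mp ⟨w, hw0, ?_⟩)
    rw [charMat_mulVec, hw1, sub_self]
  have hw2 : exp ((h : ℂ) • Ac) *ᵥ (w : n → ℂ) = z • (w : n → ℂ) := by
    have := Module.End.mem_eigenspace_iff.mp w.2
    simpa [hf] using this
  have hw3 : exp ((h : ℂ) • Ac) *ᵥ (w : n → ℂ) = Complex.exp (h * μ) • (w : n → ℂ) :=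
    exp_mulVec_eigenvector (by rw [Matrix.smul_mulVec, hw1, smul_smul])
  have hz : z = Complex.exp (h * μ) := smul_left_injective ℂ hw0 (hw2.symm.trans hw3)
  rw [hz, Complex.norm_exp]
  simpa using mul_neg_of_pos_of_neg hh hre

theorem IsHurwitz.summable_exp_pow {n : Type*} [Fintype n] [DecidableEq n]
    {A : Matrix n n ℝ} (hA : IsHurwitz A) {h : ℝ} (hh : 0 < h) :
    Summable (fun k : ℕ => (exp (h • A)) ^ k) := by
  have h1 := summable_pow_of_spectrum_lt _ (hA.norm_lt_one hh)
  have h2 := h1.map (Complex.reCLM.toLinearMap.toAddMonoidHom.mapMatrix (m := n) (n := n))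
    (Continuous.matrix_map continuous_id Complex.continuous_re)
  convert h2 using 2 with k
  have := map_pow (Complex.ofRealHom.mapMatrix (m := n)) (exp (h • A)) k
  ext i j
  exact congrArg Complex.re (congrFun (congrFun this i) j)

theorem exp_natCast_smul {n : Type*} [Fintype n] [DecidableEq n] (A : Matrix n n ℝ) (k : ℕ)
    (h : ℝ) : exp (((k : ℝ) * h) • A) = exp (h • A) ^ k := by
  rw [← Matrix.exp_nsmul, ← smul_smul, Nat.cast_smul_eq_nsmul]

/-! ### Resolvents at large real arguments and Markov parameters. -/

/-- Factor `t I - A = t (I - A / t)`; the second factor tends to the identity, so its determinant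
tends to 1 and its inverse to the identity. -/
theorem charMat_eventually_inv {n : Type*} [Fintype n] [DecidableEq n] (A : Matrix n n ℝ) :
    (∀ᶠ t : ℝ in atTop, ¬ IsEig A (t : ℂ)) ∧
      Tendsto (fun t : ℝ => (charMat A (t : ℂ))⁻¹) atTop (𝓝 0) := by
  set Ac : Matrix n n ℂ := A.map (fun a => (a : ℂ)) with hAc
  have hinv : Tendsto (fun t : ℝ => ((t : ℂ))⁻¹) atTop (𝓝 0) := by
    have := (Complex.continuous_ofReal.tendsto 0).comp tendsto_inv_atTop_zero
    simpa [Function.comp_def] using this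
  have hN : Tendsto (fun t : ℝ => (1 : Matrix n n ℂ) - ((t : ℂ))⁻¹ • Ac) atTop (𝓝 1) := by
    simpa using tendsto_const_nhds.sub (hinv.smul_const Ac)
  have hdet : Tendsto (fun t : ℝ => ((1 : Matrix n n ℂ) - ((t : ℂ))⁻¹ • Ac).det) atTop (𝓝 1) := by
    rw [← Matrix.det_one (n := n)]
    exact ((continuous_id.matrix_det (A := fun M : Matrix n n ℂ => M)).tendsto 1).comp hN
  have hfac : ∀ t : ℝ, 0 < t →
      charMat A (t : ℂ) = (t : ℂ) • ((1 : Matrix n n ℂ) - ((t : ℂ))⁻¹ • Ac) := by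
    intro t ht
    rw [smul_sub, smul_smul, mul_inv_cancel₀ (by exact_mod_cast ht.ne'), one_smul, charMat]
  have hne := hdet.eventually_ne one_ne_zero
  have hNinv : Tendsto (fun t : ℝ => ((1 : Matrix n n ℂ) - ((t : ℂ))⁻¹ • Ac)⁻¹) atTop (𝓝 1) := by
    have hc : ContinuousAt (fun M : Matrix n n ℂ => M⁻¹) 1 :=
      continuousAt_matrix_inv 1 (by
        rw [Matrix.det_one]
        exact NormedRing.inverse_continuousAt (1 : ℂˣ))
    have := hc.tendsto.comp hN
    rwa [inv_one] at this
  constructor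
  · filter_upwards [hne, eventually_gt_atTop 0] with t h1 h2
    rw [IsEig, hfac t h2, Matrix.det_smul]
    exact mul_ne_zero (pow_ne_zero _ (by exact_mod_cast h2.ne')) h1
  · have h0 := hinv.smul hNinv
    rw [zero_smul] at h0
    refine h0.congr' ?_
    filter_upwards [hne, eventually_gt_atTop 0] with t h1 h2
    have ht : (t : ℂ) ≠ 0 := by exact_mod_cast h2.ne'
    symm
    apply Matrix.inv_eq_right_inv
    rw [hfac t h2, Matrix.smul_mul, Matrix.mul_smul, smul_smul, mul_inv_cancel₀ ht, one_smul]
    exact Matrix.mul_nonsing_inv _ (isUnit_iff_ne_zero.mpr h1)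

theorem tendsto_resolvent_form {n : Type*} [Fintype n] [DecidableEq n] (A : Matrix n n ℝ)
    (C B : n → ℂ) :
    Tendsto (fun t : ℝ => C ⬝ᵥ ((charMat A (t : ℂ))⁻¹ *ᵥ B)) atTop (𝓝 0) := by
  have hc : Continuous fun M : Matrix n n ℂ => C ⬝ᵥ (M *ᵥ B) :=
    continuous_const.dotProduct (continuous_id.matrix_mulVec continuous_const)
  simpa [Function.comp_def] using (hc.tendsto 0).comp (charMat_eventually_inv A).2

/-- The resolvent identity `s R = I + A R`. It peels off the leading Markov parameter `C B` and
leaves a form of the same shape with row `C A`. -/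
theorem resolvent_form_step {n : Type*} [Fintype n] [DecidableEq n] {A : Matrix n n ℝ}
    (C B : n → ℂ) {s : ℂ} (hs : ¬ IsEig A s) :
    s * (C ⬝ᵥ ((charMat A s)⁻¹ *ᵥ B)) = C ⬝ᵥ B +
      (C ᵥ* A.map (fun a => (a : ℂ))) ⬝ᵥ ((charMat A s)⁻¹ *ᵥ B) := by
  have h : charMat A s *ᵥ ((charMat A s)⁻¹ *ᵥ B) = B := by
    rw [Matrix.mulVec_mulVec, Matrix.mul_nonsing_inv _ (isUnit_iff_ne_zero.mpr hs),
      Matrix.one_mulVec]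
  rw [charMat_mulVec] at h
  have h' := congrArg (fun w => C ⬝ᵥ w) h
  simp only [dotProduct_sub, dotProduct_smul, smul_eq_mul] at h'
  rw [← Matrix.dotProduct_mulVec]
  linear_combination h'

/-- Two transfer functions adding up to a constant for all large arguments have opposite Markov
parameters. -/
theorem markov_add_eq_zero {n m : Type*} [Fintype n] [DecidableEq n] [Fintype m] [DecidableEq m]
    {A₁ : Matrix n n ℝ} {A₂ : Matrix m m ℝ} {B₁ : n → ℂ} {B₂ : m → ℂ} (k : ℕ) :
    ∀ (C₁ : n → ℂ) (C₂ : m → ℂ) (D : ℂ),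
      (∀ᶠ t : ℝ in atTop, C₁ ⬝ᵥ ((charMat A₁ (t : ℂ))⁻¹ *ᵥ B₁) +
        C₂ ⬝ᵥ ((charMat A₂ (t : ℂ))⁻¹ *ᵥ B₂) + D = 0) →
      C₁ ⬝ᵥ ((A₁.map (fun a => (a : ℂ))) ^ k *ᵥ B₁) +
        C₂ ⬝ᵥ ((A₂.map (fun a => (a : ℂ))) ^ k *ᵥ B₂) = 0 := by
  -- The resolvent terms decay at infinity, so the constant must vanish.
  have key : ∀ (C₁ : n → ℂ) (C₂ : m → ℂ) (D : ℂ),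
      (∀ᶠ t : ℝ in atTop, C₁ ⬝ᵥ ((charMat A₁ (t : ℂ))⁻¹ *ᵥ B₁) +
        C₂ ⬝ᵥ ((charMat A₂ (t : ℂ))⁻¹ *ᵥ B₂) + D = 0) → D = 0 := by
    intro C₁ C₂ D h
    have h1 := ((tendsto_resolvent_form A₁ C₁ B₁).add
      (tendsto_resolvent_form A₂ C₂ B₂)).add_const D
    have h2 := tendsto_nhds_unique h1 ((tendsto_congr' h).mpr tendsto_const_nhds)
    simpa using h2
  have step : ∀ (C₁ : n → ℂ) (C₂ : m → ℂ) (D : ℂ),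
      (∀ᶠ t : ℝ in atTop, C₁ ⬝ᵥ ((charMat A₁ (t : ℂ))⁻¹ *ᵥ B₁) +
        C₂ ⬝ᵥ ((charMat A₂ (t : ℂ))⁻¹ *ᵥ B₂) + D = 0) →
      (∀ᶠ t : ℝ in atTop,
        (C₁ ᵥ* A₁.map (fun a => (a : ℂ))) ⬝ᵥ ((charMat A₁ (t : ℂ))⁻¹ *ᵥ B₁) +
        (C₂ ᵥ* A₂.map (fun a => (a : ℂ))) ⬝ᵥ ((charMat A₂ (t : ℂ))⁻¹ *ᵥ B₂) +
        (C₁ ⬝ᵥ B₁ + C₂ ⬝ᵥ B₂) = 0) := by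
    intro C₁ C₂ D h
    have hD := key C₁ C₂ D h
    filter_upwards [h, (charMat_eventually_inv A₁).1, (charMat_eventually_inv A₂).1]
      with t h0 h1 h2
    have e1 := resolvent_form_step C₁ B₁ h1
    have e2 := resolvent_form_step C₂ B₂ h2
    rw [hD] at h0
    linear_combination (t : ℂ) * h0 - e1 - e2
  -- The rows and the constant stay universally quantified, since each step replaces the rows by `C₁
  -- A₁`, `C₂ A₂` and the constant by `C₁ B₁ + C₂ B₂`.
  induction k with
  | zero =>
    intro C₁ C₂ D h
    simpa using key _ _ _ (step C₁ C₂ D h)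
  | succ k ih =>
    intro C₁ C₂ D h
    have := ih _ _ _ (step C₁ C₂ D h)
    simpa only [← Matrix.dotProduct_mulVec, Matrix.mulVec_mulVec, ← pow_succ'] using this

theorem dotProduct_ofReal_pow {n : Type*} [Fintype n] [DecidableEq n] (A : Matrix n n ℝ)
    (B C : n → ℝ) (k : ℕ) :
    (fun i => (C i : ℂ)) ⬝ᵥ ((A.map (fun a => (a : ℂ))) ^ k *ᵥ (fun i => (B i : ℂ)))
      = ((C ⬝ᵥ (A ^ k *ᵥ B) : ℝ) : ℂ) := by
  have h1 : (A.map (fun a => (a : ℂ))) ^ k = (A ^ k).map (fun a => (a : ℂ)) :=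
    (map_pow (Complex.ofRealHom.mapMatrix (m := n)) A k).symm
  rw [h1]
  simp [dotProduct, Matrix.mulVec]

/-- The coefficients of the two exponential series are Markov parameters divided by factorials and
cancel term by term. This passes from transfer functions to impulse responses without inverting a
Laplace transform. -/
theorem dotProduct_exp_add_eq_zero {n m : Type*} [Fintype n] [DecidableEq n] [Fintype m]
    [DecidableEq m] {A₁ : Matrix n n ℝ} {A₂ : Matrix m m ℝ} {B₁ C₁ : n → ℝ} {B₂ C₂ : m → ℝ} {D : ℂ}
    (h : ∀ᶠ t : ℝ in atTop,
      (fun i => (C₁ i : ℂ)) ⬝ᵥ ((charMat A₁ (t : ℂ))⁻¹ *ᵥ (fun i => (B₁ i : ℂ))) +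
      (fun i => (C₂ i : ℂ)) ⬝ᵥ ((charMat A₂ (t : ℂ))⁻¹ *ᵥ (fun i => (B₂ i : ℂ))) + D = 0) (τ : ℝ) :
    C₁ ⬝ᵥ (exp (τ • A₁) *ᵥ B₁) + C₂ ⬝ᵥ (exp (τ • A₂) *ᵥ B₂) = 0 := by
  have hk : ∀ k : ℕ, C₁ ⬝ᵥ (A₁ ^ k *ᵥ B₁) + C₂ ⬝ᵥ (A₂ ^ k *ᵥ B₂) = 0 := by
    intro k
    have := markov_add_eq_zero k _ _ _ h
    rw [dotProduct_ofReal_pow, dotProduct_ofReal_pow] at this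
    exact_mod_cast this
  have s1 := (hasSum_matrix_exp (τ • A₁)).mapL (LinearMap.toContinuousLinearMap
    ((dotProductBilin ℝ ℝ C₁).comp ((Matrix.mulVecBilin ℝ ℝ).flip B₁)))
  have s2 := (hasSum_matrix_exp (τ • A₂)).mapL (LinearMap.toContinuousLinearMap
    ((dotProductBilin ℝ ℝ C₂).comp ((Matrix.mulVecBilin ℝ ℝ).flip B₂)))
  refine (s1.add s2).unique ?_
  convert hasSum_zero with k
  have := hk k
  simp [smul_pow, ← mul_add, this]

/-! ### State-space algebra, valid both for real signals and for complex phasors. -/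

/-- State derivative of `S` over an extension field of `ℝ`. -/
def SISO.rhs {𝕜 n : Type*} [Field 𝕜] [Fintype n] (φ : ℝ →+* 𝕜) (S : SISO n) (x : n → 𝕜) (v : 𝕜) :
    n → 𝕜 :=
  S.A.map φ *ᵥ x + v • (fun i => φ (S.B i))

/-- Output of `S` over an extension field of `ℝ`. -/
def SISO.out {𝕜 n : Type*} [Field 𝕜] [Fintype n] (φ : ℝ →+* 𝕜) (S : SISO n) (x : n → 𝕜) (v : 𝕜) :
    𝕜 :=
  (fun i => φ (S.C i)) ⬝ᵥ x + φ S.D * v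

section Algebra

variable {𝕜 n n₁ n₂ : Type*} [Field 𝕜] [Fintype n] [Fintype n₁] [Fintype n₂] (φ : ℝ →+* 𝕜)

theorem SISO.series_out (S₁ : SISO n₁) (S₂ : SISO n₂) (x₁ : n₁ → 𝕜) (x₂ : n₂ → 𝕜) (v : 𝕜) :
    (S₁.series S₂).out φ (Sum.elim x₁ x₂) v = S₂.out φ x₂ (S₁.out φ x₁ v) := by
  simp only [SISO.out, SISO.series, dotProduct, Fintype.sum_sum_type, Sum.elim_inl, Sum.elim_inr,
    Pi.smul_apply, smul_eq_mul, map_mul, mul_add, Finset.mul_sum]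
  simp only [mul_assoc]
  ring

theorem SISO.series_rhs (S₁ : SISO n₁) (S₂ : SISO n₂) (x₁ : n₁ → 𝕜) (x₂ : n₂ → 𝕜) (v : 𝕜) :
    (S₁.series S₂).rhs φ (Sum.elim x₁ x₂) v
      = Sum.elim (S₁.rhs φ x₁ v) (S₂.rhs φ x₂ (S₁.out φ x₁ v)) := by
  ext i
  rcases i with i | i
  · simp [SISO.rhs, SISO.series, Matrix.mulVec, dotProduct]
  · simp only [SISO.rhs, SISO.out, SISO.series, Matrix.mulVec, dotProduct, Fintype.sum_sum_type,
      Sum.elim_inl, Sum.elim_inr, Pi.add_apply, Pi.smul_apply, smul_eq_mul, map_mul, add_mul,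
      Finset.sum_mul, Matrix.map_apply, Matrix.fromBlocks_apply₂₁, Matrix.fromBlocks_apply₂₂,
      Matrix.vecMulVec_apply]
    rw [Finset.sum_congr rfl fun j _ => (by ring :
      φ (S₂.B i) * φ (S₁.C j) * x₁ j = φ (S₁.C j) * x₁ j * φ (S₂.B i))]
    ring

/-- The error signal solving the algebraic loop for the state `x` and the reference `ρ`. -/
def SISO.loopError (S : SISO n) (x : n → 𝕜) (ρ : 𝕜) : 𝕜 :=
  (φ (1 + S.D))⁻¹ * (ρ - (fun i => φ (S.C i)) ⬝ᵥ x)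

theorem SISO.eq_loopError_iff {S : SISO n} (hS : 1 + S.D ≠ 0) (x : n → 𝕜) (ρ e : 𝕜) :
    e = ρ - S.out φ x e ↔ e = S.loopError φ x ρ := by
  have h : φ (1 + S.D) ≠ 0 := (map_ne_zero φ).mpr hS
  rw [SISO.loopError, eq_inv_mul_iff_mul_eq₀ h, SISO.out, map_add, map_one]
  constructor <;> intro H <;> linear_combination H

theorem SISO.rhs_loopError (S : SISO n) (x : n → 𝕜) (ρ : 𝕜) :
    S.rhs φ x (S.loopError φ x ρ) = S.feedbackMatrix.map φ *ᵥ x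
      + ((φ (1 + S.D))⁻¹ * ρ) • (fun i => φ (S.B i)) := by
  ext i
  simp only [SISO.rhs, SISO.loopError, SISO.feedbackMatrix, Matrix.mulVec, dotProduct,
    Pi.add_apply, Pi.smul_apply, smul_eq_mul, Matrix.map_apply, Matrix.sub_apply,
    Matrix.smul_apply, Matrix.vecMulVec_apply, map_sub, map_mul, map_inv₀, sub_mul,
    Finset.sum_sub_distrib]
  rw [Finset.sum_congr rfl fun j _ => (by ring :
    (φ (1 + S.D))⁻¹ * (φ (S.B i) * φ (S.C j)) * x j
      = ((φ (1 + S.D))⁻¹ * φ (S.B i)) * (φ (S.C j) * x j)), ← Finset.mul_sum]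
  ring

end Algebra

/-- Solve the state equation with the resolvent. The extra input `w` to the state is what models a
reset jump. -/
theorem SISO.out_of_eq_rhs {n : Type*} [Fintype n] [DecidableEq n] (S : SISO n) {s : ℂ}
    (hs : ¬ IsEig S.A s) {x w : n → ℂ} {v : ℂ} (h : s • x = S.rhs Complex.ofRealHom x v + w) :
    S.out Complex.ofRealHom x v = S.transfer s * v
      + (fun i => (S.C i : ℂ)) ⬝ᵥ ((charMat S.A s)⁻¹ *ᵥ w) := by
  have h1 : charMat S.A s *ᵥ x = v • (fun i => (S.B i : ℂ)) + w := by
    rw [charMat_mulVec, h]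
    simp only [SISO.rhs]
    have : S.A.map (fun a => (a : ℂ)) = S.A.map Complex.ofRealHom := rfl
    rw [this]
    ext i
    simp
    ring
  have h2 : x = (charMat S.A s)⁻¹ *ᵥ (v • (fun i => (S.B i : ℂ)) + w) := by
    rw [← h1, Matrix.mulVec_mulVec, Matrix.nonsing_inv_mul _ (isUnit_iff_ne_zero.mpr hs),
      Matrix.one_mulVec]
  have h3 : S.out Complex.ofRealHom x v
      = (fun i => (S.C i : ℂ)) ⬝ᵥ x + (S.D : ℂ) * v := rfl
  rw [h3, h2, SISO.transfer, Matrix.mulVec_add, Matrix.mulVec_smul, dotProduct_add,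
    dotProduct_smul, smul_eq_mul]
  ring

/-! ### The closed loop in the frequency domain. -/

section Loop

variable {nK nR nG : Type*} [Fintype nK] [Fintype nR] [Fintype nG]

/-- The signal `q` as a function of the loop state `X` is `rowQ ⬝ X + feedQ * r`. -/
def Loop.rowQ (P : Loop nK nR nG) : (nK ⊕ nR) ⊕ nG → ℝ :=
  Sum.elim (Sum.elim P.K.C 0) 0 - (P.K.D * (1 + P.openLoop.D)⁻¹) • P.openLoop.C

/-- The direct feedthrough from the reference to `q`. -/
def Loop.feedQ (P : Loop nK nR nG) : ℝ := P.K.D * (1 + P.openLoop.D)⁻¹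

theorem Loop.out_loopError {𝕜 : Type*} [Field 𝕜] (φ : ℝ →+* 𝕜) (P : Loop nK nR nG)
    (a : nK → 𝕜) (b : nR → 𝕜) (c : nG → 𝕜) (ρ : 𝕜) :
    P.K.out φ a (P.openLoop.loopError φ (Sum.elim (Sum.elim a b) c) ρ)
      = (fun i => φ (P.rowQ i)) ⬝ᵥ (Sum.elim (Sum.elim a b) c) + φ P.feedQ * ρ := by
  simp only [SISO.out, SISO.loopError, Loop.rowQ, Loop.feedQ, dotProduct, Pi.sub_apply,
    Pi.smul_apply, smul_eq_mul, map_sub, map_mul, sub_mul, Finset.sum_sub_distrib, map_inv₀,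
    mul_assoc, ← Finset.mul_sum]
  have : ∑ x, φ ((Sum.elim (Sum.elim P.K.C 0) 0 : (nK ⊕ nR) ⊕ nG → ℝ) x)
      * Sum.elim (Sum.elim a b) c x = ∑ x, φ (P.K.C x) * a x := by
    simp [Fintype.sum_sum_type]
  rw [this]
  ring

variable [DecidableEq nK] [DecidableEq nR] [DecidableEq nG]

/-- The loop state that vanishes except for the state `b` of the reset controller. -/
def stateR {nK nR nG 𝕜 : Type*} [Zero 𝕜] (b : nR → 𝕜) : (nK ⊕ nR) ⊕ nG → 𝕜 :=
  Sum.elim (Sum.elim 0 b) 0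

/-- Transfer relations of the closed loop with reference `ρ` and an input `b` to the state of the
reset controller. -/
theorem Loop.transfer_relations {P : Loop nK nR nG} (hP : P.WellPosed) {s : ℂ}
    (hs : P.NoPoleAt s) {X : (nK ⊕ nR) ⊕ nG → ℂ} {ρ : ℂ} {b : nR → ℂ}
    (h : charMat P.openLoop.feedbackMatrix s *ᵥ X
      = (((1 + P.openLoop.D : ℝ) : ℂ)⁻¹ * ρ) • (fun i => (P.openLoop.B i : ℂ))
        + stateR b) :
    ∃ e : ℂ, e = P.openLoop.loopError Complex.ofRealHom X ρ ∧
      e * (1 + P.L s)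
        = ρ - P.G.transfer s * ((fun i => (P.R.C i : ℂ)) ⬝ᵥ ((charMat P.R.A s)⁻¹ *ᵥ b)) ∧
      (fun i => (P.rowQ i : ℂ)) ⬝ᵥ X + (P.feedQ : ℂ) * ρ = P.K.transfer s * e := by
  obtain ⟨a, r, g, rfl⟩ : ∃ a r g, X = Sum.elim (Sum.elim a r) g :=
    ⟨fun i => X (.inl (.inl i)), fun i => X (.inl (.inr i)), fun i => X (.inr i), by
      ext i; rcases i with (i | i) | i <;> rfl⟩
  set X := Sum.elim (Sum.elim a r) g with hX
  set e := P.openLoop.loopError Complex.ofRealHom X ρ with he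
  have hrhs := P.openLoop.rhs_loopError Complex.ofRealHom X ρ
  rw [← he] at hrhs
  have hX1 : s • X = P.openLoop.rhs Complex.ofRealHom X e + stateR b := by
    rw [charMat_mulVec, sub_eq_iff_eq_add] at h
    rw [h, hrhs, add_comm, ← add_assoc]
    rfl
  have hout : e = ρ - P.openLoop.out Complex.ofRealHom X e :=
    (SISO.eq_loopError_iff Complex.ofRealHom hP X ρ e).mpr he
  rw [Loop.openLoop, hX, SISO.series_rhs, SISO.series_rhs, SISO.series_out] at hX1
  rw [Loop.openLoop, hX, SISO.series_out, SISO.series_out] at hout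
  set q := P.K.out Complex.ofRealHom a e with hq
  set u := P.R.toSISO.out Complex.ofRealHom r q with hu
  have hK : s • a = P.K.rhs Complex.ofRealHom a e + 0 := by
    ext i; simpa [stateR] using congrFun hX1 (.inl (.inl i))
  have hR : s • r = P.R.toSISO.rhs Complex.ofRealHom r q + b := by
    ext i; simpa [stateR] using congrFun hX1 (.inl (.inr i))
  have hG : s • g = P.G.rhs Complex.ofRealHom g u + 0 := by
    ext i; simpa [stateR] using congrFun hX1 (.inr i)
  have hK' := P.K.out_of_eq_rhs hs.1 hK
  have hR' := P.R.toSISO.out_of_eq_rhs hs.2.1 hR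
  have hG' := P.G.out_of_eq_rhs hs.2.2 hG
  rw [Matrix.mulVec_zero, dotProduct_zero, add_zero] at hK' hG'
  have hqr := P.out_loopError Complex.ofRealHom a r g ρ
  rw [← hX, ← he] at hqr
  refine ⟨e, rfl, ?_, ?_⟩
  · rw [hG', hu, hR', hq, hK'] at hout
    rw [Loop.L]
    linear_combination hout
  · rw [← hK']
    exact hqr.symm

theorem SISO.tendsto_transfer {n : Type*} [Fintype n] [DecidableEq n] (S : SISO n) :
    Tendsto (fun t : ℝ => S.transfer (t : ℂ)) atTop (𝓝 (S.D : ℂ)) := by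
  simpa [SISO.transfer] using
    (tendsto_resolvent_form S.A (fun i => (S.C i : ℂ)) (fun i => (S.B i : ℂ))).add_const (S.D : ℂ)

/-- At infinity only the feedthroughs survive, and the limit is nonzero by well-posedness. -/
theorem Loop.eventually_ne {P : Loop nK nR nG} (hP : P.WellPosed) :
    ∀ᶠ t : ℝ in atTop, 1 + P.L (t : ℂ) ≠ 0 := by
  have h : Tendsto (fun t : ℝ => 1 + P.L (t : ℂ)) atTop
      (𝓝 (1 + (P.G.D : ℂ) * (P.R.D : ℂ) * (P.K.D : ℂ))) :=
    (((P.G.tendsto_transfer).mul (P.R.toSISO.tendsto_transfer)).mul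
      (P.K.tendsto_transfer)).const_add 1
  refine h.eventually_ne ?_
  have hP' : 1 + P.G.D * (P.R.D * P.K.D) ≠ 0 := hP
  rw [← mul_assoc] at hP'
  exact_mod_cast hP'

/-- The impulse response of `Q_δ` in terms of the closed-loop matrix. -/
theorem Loop.rowQ_exp_eq {nQ : Type*} [Fintype nQ] [DecidableEq nQ] {P : Loop nK nR nG}
    (hP : P.WellPosed) {S : MISO nQ nR} (hS : P.IsRealizationQδ S) (v : nR → ℝ) (τ : ℝ) :
    P.rowQ ⬝ᵥ (exp (τ • P.openLoop.feedbackMatrix) *ᵥ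
      stateR ((P.R.Aρ - 1) *ᵥ v)) = -S.impulse τ v := by
  rw [eq_neg_iff_add_eq_zero]
  -- The realization may carry a feedthrough `S.D`; it enters as the constant term. The sign of the
  -- impulse response comes from the negative feedback.
  refine dotProduct_exp_add_eq_zero (D := (fun i => (S.D i : ℂ)) ⬝ᵥ (fun i => (v i : ℂ))) ?_ τ
  filter_upwards [Loop.eventually_ne hP, (charMat_eventually_inv P.K.A).1,
    (charMat_eventually_inv P.R.A).1, (charMat_eventually_inv P.G.A).1,
    (charMat_eventually_inv S.A).1, (charMat_eventually_inv P.openLoop.feedbackMatrix).1]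
    with t h1 h2 h3 h4 h5 h6
  have hreal := congrArg (fun w => w ⬝ᵥ (fun i => (v i : ℂ))) (hS t ⟨h2, h3, h4⟩ h1 h5)
  set b : nR → ℂ := fun i => (((P.R.Aρ - 1) *ᵥ v) i : ℂ) with hb
  have hE : (fun i => ((stateR ((P.R.Aρ - 1) *ᵥ v) : (nK ⊕ nR) ⊕ nG → ℝ) i : ℂ))
      = stateR b := by
    ext i; rcases i with (i | i) | i <;> simp [hb, stateR]
  rw [hE]
  set X := (charMat P.openLoop.feedbackMatrix (t : ℂ))⁻¹ *ᵥ
    stateR b with hX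
  obtain ⟨e, -, he, hq⟩ := Loop.transfer_relations hP (X := X) (ρ := 0) (b := b)
    (show P.NoPoleAt (t : ℂ) from ⟨h2, h3, h4⟩) (by
      rw [hX, Matrix.mulVec_mulVec, Matrix.mul_nonsing_inv _ (isUnit_iff_ne_zero.mpr h6),
        Matrix.one_mulVec, mul_zero, zero_smul, zero_add])
  rw [mul_zero, add_zero] at hq
  have hb' : b = (P.R.Aρ - 1).map (fun a => (a : ℂ)) *ᵥ (fun i => (v i : ℂ)) := by
    ext i; simp [hb, Matrix.mulVec, dotProduct]
  have hB' : (fun i => ((S.B *ᵥ v) i : ℂ))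
      = S.B.map (fun a => (a : ℂ)) *ᵥ (fun i => (v i : ℂ)) := by
    ext i; simp [Matrix.mulVec, dotProduct]
  rw [hq, hB']
  simp only [MISO.transfer, Loop.Qδ, ResetController.Rδ, add_dotProduct, smul_dotProduct,
    ← Matrix.dotProduct_mulVec, ← Matrix.mulVec_mulVec, ← hb', Loop.SL, smul_eq_mul] at hreal
  have he' : e = (1 + P.L t)⁻¹ *
      (0 - P.G.transfer t * ((fun i => (P.R.C i : ℂ)) ⬝ᵥ ((charMat P.R.A t)⁻¹ *ᵥ b))) := by
    rw [eq_inv_mul_iff_mul_eq₀ h1, mul_comm, he]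
  rw [he']
  linear_combination hreal

/-- The steady-state phasor of `q` in the base linear system is `K S_L R_I`. -/
theorem Loop.exists_phasor_state {P : Loop nK nR nG} (hP : P.WellPosed) (hst : P.BLSStable)
    {ω : ℝ} (hs : P.NoPoleAt (ω * Complex.I)) (RI : ℂ) :
    ∃ X : (nK ⊕ nR) ⊕ nG → ℂ,
      (ω * Complex.I) • X = P.openLoop.feedbackMatrix.map (fun a => (a : ℂ)) *ᵥ X
        + (((1 + P.openLoop.D : ℝ) : ℂ)⁻¹ * RI) • (fun i => (P.openLoop.B i : ℂ)) ∧
      (fun i => (P.rowQ i : ℂ)) ⬝ᵥ X + (P.feedQ : ℂ) * RI = P.phasor ω RI := by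
  have hne : ¬ IsEig P.openLoop.feedbackMatrix (ω * Complex.I) := fun h => by
    simpa using hst _ h
  set Y : (nK ⊕ nR) ⊕ nG → ℂ :=
    (((1 + P.openLoop.D : ℝ) : ℂ)⁻¹ * RI) • (fun i => (P.openLoop.B i : ℂ)) with hY
  set X := (charMat P.openLoop.feedbackMatrix (ω * Complex.I))⁻¹ *ᵥ Y with hX
  have hXY : charMat P.openLoop.feedbackMatrix (ω * Complex.I) *ᵥ X = Y := by
    rw [hX, Matrix.mulVec_mulVec, Matrix.mul_nonsing_inv _ (isUnit_iff_ne_zero.mpr hne),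
      Matrix.one_mulVec]
  refine ⟨X, ?_, ?_⟩
  · rw [charMat_mulVec, sub_eq_iff_eq_add] at hXY
    rw [hXY, add_comm]
  · obtain ⟨e, hee, he, hq⟩ := Loop.transfer_relations hP hs (X := X) (ρ := RI) (b := 0) (by
      rw [hXY, stateR, Sum.elim_zero_zero, Sum.elim_zero_zero, add_zero])
    rw [hq, Loop.phasor, Loop.SL]
    rw [Matrix.mulVec_zero, dotProduct_zero, mul_zero, sub_zero] at he
    -- If `1 + L(jω)` vanishes, the loop relation forces `RI = 0`. Then `X` and `e` are zero and
    -- both sides vanish, whatever value the inverse takes.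
    by_cases h0 : 1 + P.L (ω * Complex.I) = 0
    · rw [h0, mul_zero] at he
      have hX0 : X = 0 := by rw [hX, hY, ← he]; simp
      rw [hee, ← he, hX0]
      simp [SISO.loopError]
    · rw [← he]
      field_simp

end Loop

/-! ### Linear flows: propagation, periodic solutions and the alternating series. -/

section
open scoped Matrix.Norms.Operator

theorem hasDerivAt_matrix_exp_apply {n : Type*} [Fintype n] [DecidableEq n]
    (A : Matrix n n ℝ) (t : ℝ) (i j : n) :
    HasDerivAt (fun u : ℝ => exp (u • A) i j) ((exp (t • A) * A) i j) t :=
  (LinearMap.toContinuousLinearMap (Matrix.entryLinearMap ℝ ℝ i j)).hasFDerivAt.comp_hasDerivAt t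
    (hasDerivAt_matrix_exp A t)

end

theorem hasDerivAt_exp_mulVec {n : Type*} [Fintype n] [DecidableEq n] (A : Matrix n n ℝ)
    {x : ℝ → n → ℝ} {x' : n → ℝ} {t : ℝ} (hx : HasDerivAt x x' t) :
    HasDerivAt (fun u : ℝ => exp (u • A) *ᵥ x u)
      ((exp (t • A) * A) *ᵥ x t + exp (t • A) *ᵥ x') t := by
  rw [hasDerivAt_pi] at hx ⊢
  intro i
  have h := HasDerivAt.fun_sum (u := Finset.univ) fun j _ =>
    (hasDerivAt_matrix_exp_apply A t i j).mul (hx j)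
  simpa [Matrix.mulVec, dotProduct, Finset.sum_add_distrib] using h

/-- Solution formula for `x' = A x` on an open interval in terms of the limits at its ends. -/
theorem eq_exp_mulVec_of_hasDerivAt {n : Type*} [Fintype n] [DecidableEq n] {A : Matrix n n ℝ}
    {x : ℝ → n → ℝ} {a b : ℝ} (hab : a < b)
    (hx : ∀ t ∈ Set.Ioo a b, HasDerivAt x (A *ᵥ x t) t) {p q : n → ℝ}
    (hp : Tendsto x (𝓝[>] a) (𝓝 p)) (hq : Tendsto x (𝓝[<] b) (𝓝 q)) :
    q = exp ((b - a) • A) *ᵥ p := by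
  -- Integrating factor: `g` is constant on the interval, so its two one-sided limits agree. Only
  -- limits of `x` at the ends are used, which allows for jumps there.
  set g : ℝ → n → ℝ := fun u => exp (u • (-A)) *ᵥ x u with hg
  have hd : ∀ t ∈ Set.Ioo a b, HasDerivAt g 0 t := by
    intro t ht
    have h := hasDerivAt_exp_mulVec (-A) (hx t ht)
    rwa [Matrix.mulVec_mulVec, ← Matrix.add_mulVec, mul_neg, neg_add_cancel,
      Matrix.zero_mulVec] at h
  have hconst : ∀ t ∈ Set.Ioo a b, g t = g ((a + b) / 2) := fun t ht =>
    isOpen_Ioo.is_const_of_deriv_eq_zero isPreconnected_Ioo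
      (fun u hu => (hd u hu).differentiableAt.differentiableWithinAt)
      (fun u hu => (hd u hu).deriv) ht ⟨by linarith, by linarith⟩
  have hcont : ∀ c : ℝ, Tendsto (fun u : ℝ => exp (u • (-A))) (𝓝 c) (𝓝 (exp (c • (-A)))) := by
    intro c
    refine tendsto_pi_nhds.mpr fun i => tendsto_pi_nhds.mpr fun j => ?_
    exact (hasDerivAt_matrix_exp_apply (-A) c i j).continuousAt
  have hmul : Continuous fun z : Matrix n n ℝ × (n → ℝ) => z.1 *ᵥ z.2 :=
    continuous_fst.matrix_mulVec continuous_snd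
  have hga : Tendsto g (𝓝[>] a) (𝓝 (exp (a • (-A)) *ᵥ p)) :=
    (hmul.tendsto (exp (a • (-A)), p)).comp
      (((hcont a).mono_left nhdsWithin_le_nhds).prodMk_nhds hp)
  have hgb : Tendsto g (𝓝[<] b) (𝓝 (exp (b • (-A)) *ᵥ q)) :=
    (hmul.tendsto (exp (b • (-A)), q)).comp
      (((hcont b).mono_left nhdsWithin_le_nhds).prodMk_nhds hq)
  have ea : exp (a • (-A)) *ᵥ p = g ((a + b) / 2) := by
    refine tendsto_nhds_unique hga (tendsto_const_nhds.congr' ?_)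
    filter_upwards [Ioo_mem_nhdsGT hab] with t ht using (hconst t ht).symm
  have eb : exp (b • (-A)) *ᵥ q = g ((a + b) / 2) := by
    refine tendsto_nhds_unique hgb (tendsto_const_nhds.congr' ?_)
    filter_upwards [Ioo_mem_nhdsLT hab] with t ht using (hconst t ht).symm
  have hadd : ∀ c d : ℝ, exp (c • A) * exp (d • (-A)) = exp ((c - d) • A) := by
    intro c d
    rw [← Matrix.exp_add_of_commute, sub_smul, smul_neg, sub_eq_add_neg]
    exact (((Commute.refl A).smul_left c).neg_right).smul_right d |>.trans (by rfl)
  have h := congrArg (fun w => exp (b • A) *ᵥ w) (eb.trans ea.symm)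
  simpa only [Matrix.mulVec_mulVec, hadd, sub_self, zero_smul, exp_zero, Matrix.one_mulVec] using h

/-- Powers of `exp (h A)` fix `v` and tend to zero. Hence a Hurwitz linear flow has no nonzero
periodic solution. -/
theorem IsHurwitz.eq_zero_of_exp_mulVec_eq {n : Type*} [Fintype n] [DecidableEq n]
    {A : Matrix n n ℝ} (hA : IsHurwitz A) {h : ℝ} (hh : 0 < h) {v : n → ℝ}
    (hv : exp (h • A) *ᵥ v = v) : v = 0 := by
  have h0 := (hA.summable_exp_pow hh).tendsto_atTop_zero
  have hc : Continuous fun M : Matrix n n ℝ => M *ᵥ v :=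
    continuous_id.matrix_mulVec continuous_const
  have h1 := (hc.tendsto 0).comp h0
  have h2 : ∀ k : ℕ, exp (h • A) ^ k *ᵥ v = v := by
    intro k
    induction k with
    | zero => simp
    | succ k ih => rw [pow_succ, ← Matrix.mulVec_mulVec, hv, ih]
  simp only [Function.comp_def, h2, Matrix.zero_mulVec] at h1
  exact tendsto_nhds_unique tendsto_const_nhds h1

/-- The alternating geometric series solves `v = -M (v + b)`. -/
theorem IsHurwitz.hasSum_alternating {n : Type*} [Fintype n] [DecidableEq n]
    {A : Matrix n n ℝ} (hA : IsHurwitz A) {h : ℝ} (hh : 0 < h) {v b : n → ℝ}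
    (hv : v = -(exp (h • A) *ᵥ (v + b))) :
    HasSum (fun k : ℕ => (-1 : ℝ) ^ (k + 1) • (exp ((((k + 1 : ℕ) : ℝ) * h) • A) *ᵥ b)) v := by
  set M := exp (h • A) with hM
  have hs : Summable fun k : ℕ => (-M) ^ k := by
    have hs := hA.summable_exp_pow hh
    refine Pi.summable.mpr fun i => Pi.summable.mpr fun j => ?_
    have h2 := (Pi.summable.mp (Pi.summable.mp hs i) j).abs
    refine Summable.of_norm_bounded h2 fun k => le_of_eq ?_
    rw [neg_pow]
    rcases neg_one_pow_eq_or (Matrix n n ℝ) k with h | h <;> rw [h] <;> simp [hM]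
  have hinv := hs.tsum_pow_mul_one_sub
  have hv' : (1 - -M) *ᵥ v = -M *ᵥ b := by
    rw [Matrix.mulVec_add] at hv
    -- The fixed-point equation reads `(1 + M) v = -M b`, and the Neumann series of `-M` inverts `1
    -- + M`.
    rw [sub_neg_eq_add, Matrix.add_mulVec, Matrix.one_mulVec, Matrix.neg_mulVec]
    nth_rewrite 1 [hv]
    abel
  have hv2 : v = (∑' k : ℕ, (-M) ^ k) *ᵥ (-M *ᵥ b) := by
    rw [← hv', Matrix.mulVec_mulVec, hinv, Matrix.one_mulVec]
  have hsum := hs.hasSum.map (Matrix.mulVecBilin ℝ ℝ |>.flip (-M *ᵥ b))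
    (by exact Continuous.matrix_mulVec continuous_id continuous_const)
  rw [hv2]
  refine hsum.congr_fun fun k => ?_
  have hk : (-M) ^ (k + 1) = (-1 : ℝ) ^ (k + 1) • M ^ (k + 1) := by
    rw [← smul_pow, neg_one_smul]
  simp only [Function.comp, LinearMap.flip_apply, Matrix.mulVecBilin_apply, Matrix.mulVec_mulVec,
    ← pow_succ, exp_natCast_smul]
  rw [← hM, hk, Matrix.smul_mulVec]

/-! ### The joint loop state as a linear system with jumps. -/

section Signals

variable {nK nR nG : Type*}

/-- The joint state of the loop. -/
def Signals.state (σ : Signals nK nR nG) (t : ℝ) : (nK ⊕ nR) ⊕ nG → ℝ :=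
  Sum.elim (Sum.elim (σ.xK t) (σ.xR t)) (σ.xG t)

variable [Fintype nK] [Fintype nR] [Fintype nG]

theorem Loop.IsResponse.e_eq {P : Loop nK nR nG} (hP : P.WellPosed) {r : ℝ → ℝ} {T : Set ℝ}
    {σ : Signals nK nR nG} (h : P.IsResponse r T σ) (t : ℝ) :
    σ.e t = P.openLoop.loopError (RingHom.id ℝ) (σ.state t) (r t) := by
  rw [← SISO.eq_loopError_iff _ hP, Signals.state, Loop.openLoop, SISO.series_out, SISO.series_out]
  have hq : P.K.out (RingHom.id ℝ) (σ.xK t) (σ.e t) = σ.q t := (h.outK t).symm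
  have hu : P.R.toSISO.out (RingHom.id ℝ) (σ.xR t) (σ.q t) = σ.u t := (h.outR t).symm
  have hy : P.G.out (RingHom.id ℝ) (σ.xG t) (σ.u t) = σ.y t := (h.outG t).symm
  rw [hq, hu, hy, h.error]

theorem Loop.IsResponse.q_eq {P : Loop nK nR nG} (hP : P.WellPosed) {r : ℝ → ℝ} {T : Set ℝ}
    {σ : Signals nK nR nG} (h : P.IsResponse r T σ) (t : ℝ) :
    σ.q t = P.rowQ ⬝ᵥ σ.state t + P.feedQ * r t := by
  have h1 := P.out_loopError (RingHom.id ℝ) (σ.xK t) (σ.xR t) (σ.xG t) (r t)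
  have h2 := h.e_eq hP t
  rw [Signals.state] at h2
  rw [← h2] at h1
  exact (h.outK t).trans h1

theorem Loop.IsResponse.hasDerivAt_state {P : Loop nK nR nG} (hP : P.WellPosed) {r : ℝ → ℝ}
    {T : Set ℝ} {σ : Signals nK nR nG} (h : P.IsResponse r T σ) {t : ℝ} (ht : t ∉ T) :
    HasDerivAt σ.state (P.openLoop.feedbackMatrix *ᵥ σ.state t
      + ((1 + P.openLoop.D)⁻¹ * r t) • P.openLoop.B) t := by
  have h1 := P.openLoop.rhs_loopError (RingHom.id ℝ) (σ.state t) (r t)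
  rw [← h.e_eq hP t] at h1
  have h2 : P.openLoop.feedbackMatrix.map (RingHom.id ℝ) = P.openLoop.feedbackMatrix := rfl
  rw [h2] at h1
  have h3 : ((RingHom.id ℝ (1 + P.openLoop.D))⁻¹ * r t)
      • (fun i => RingHom.id ℝ (P.openLoop.B i)) = ((1 + P.openLoop.D)⁻¹ * r t) • P.openLoop.B := rfl
  rw [h3] at h1
  rw [← h1, Signals.state, Loop.openLoop, SISO.series_rhs, SISO.series_rhs, SISO.series_out]
  have hq : P.K.out (RingHom.id ℝ) (σ.xK t) (σ.e t) = σ.q t := (h.outK t).symm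
  have hu : P.R.toSISO.out (RingHom.id ℝ) (σ.xR t) (σ.q t) = σ.u t := (h.outR t).symm
  rw [hq, hu]
  rw [hasDerivAt_pi]
  rintro ((i | i) | i)
  · exact (hasDerivAt_pi.mp (h.flowK t ht)) i
  · exact (hasDerivAt_pi.mp (h.flowR t ht)) i
  · exact (hasDerivAt_pi.mp (h.flowG t ht)) i

theorem Loop.IsResponse.tendsto_left {P : Loop nK nR nG} {r : ℝ → ℝ}
    {T : Set ℝ} {σ : Signals nK nR nG} (h : P.IsResponse r T σ) {t : ℝ} (ht : t ∈ T) :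
    Tendsto σ.state (𝓝[<] t) (𝓝 (σ.state t)) := by
  refine tendsto_pi_nhds.mpr ?_
  rintro ((i | i) | i)
  · exact tendsto_pi_nhds.mp ((h.contK t ht).tendsto.mono_left nhdsWithin_le_nhds) i
  · exact tendsto_pi_nhds.mp (h.leftR t ht) i
  · exact tendsto_pi_nhds.mp ((h.contG t ht).tendsto.mono_left nhdsWithin_le_nhds) i

theorem Loop.IsResponse.tendsto_right [DecidableEq nR] {P : Loop nK nR nG} {r : ℝ → ℝ}
    {T : Set ℝ} {σ : Signals nK nR nG} (h : P.IsResponse r T σ) {t : ℝ} (ht : t ∈ T) :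
    Tendsto σ.state (𝓝[>] t) (𝓝 (σ.state t + stateR ((P.R.Aρ - 1) *ᵥ σ.xR t))) := by
  refine tendsto_pi_nhds.mpr ?_
  rintro ((i | i) | i)
  · simpa [Signals.state, stateR] using
      tendsto_pi_nhds.mp ((h.contK t ht).tendsto.mono_left nhdsWithin_le_nhds) i
  · simpa [Signals.state, stateR, Matrix.sub_mulVec] using tendsto_pi_nhds.mp (h.jumpR t ht) i
  · simpa [Signals.state, stateR] using
      tendsto_pi_nhds.mp ((h.contG t ht).tendsto.mono_left nhdsWithin_le_nhds) i

end Signals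

/-! ### Sinusoids and the steady state of the base linear system. -/

theorem sinusoid_eq_im (ω : ℝ) (z : ℂ) (t : ℝ) :
    sinusoid ω z t = (z * Complex.exp (ω * t * Complex.I)).im := by
  conv_rhs => rw [← Complex.norm_mul_exp_arg_mul_I z, mul_assoc, ← Complex.exp_add, ← add_mul,
    ← Complex.ofReal_mul, ← Complex.ofReal_add, Complex.im_ofReal_mul, Complex.exp_ofReal_mul_I_im]
  rw [sinusoid, add_comm]

theorem hasDerivAt_sinusoid (ω : ℝ) (z : ℂ) (t : ℝ) :
    HasDerivAt (sinusoid ω z) (sinusoid ω (ω * Complex.I * z) t) t := by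
  have h1 : HasDerivAt (fun u : ℝ => z * Complex.exp (ω * u * Complex.I))
      (z * (Complex.exp (ω * t * Complex.I) * (ω * Complex.I))) t := by
    have h2 : HasDerivAt (fun u : ℝ => (ω : ℂ) * u * Complex.I) (ω * Complex.I) t := by
      simpa using ((Complex.ofRealCLM.hasDerivAt (x := t)).const_mul (ω : ℂ)).mul_const Complex.I
    exact (h2.cexp).const_mul z
  have h3 := Complex.imCLM.hasFDerivAt.comp_hasDerivAt t h1
  have h4 : sinusoid ω z = fun u : ℝ => (z * Complex.exp (ω * u * Complex.I)).im :=
    funext (sinusoid_eq_im ω z)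
  rw [h4, sinusoid_eq_im]
  refine h3.congr_deriv ?_
  simp only [Complex.imCLM_apply]
  congr 1
  ring

theorem sinusoid_add (ω : ℝ) (z w : ℂ) (t : ℝ) :
    sinusoid ω (z + w) t = sinusoid ω z t + sinusoid ω w t := by
  simp only [sinusoid_eq_im, add_mul, Complex.add_im]

theorem sinusoid_ofReal_mul (ω a : ℝ) (z : ℂ) (t : ℝ) :
    sinusoid ω (a * z) t = a * sinusoid ω z t := by
  simp only [sinusoid_eq_im, mul_assoc, Complex.im_ofReal_mul]

theorem sinusoid_sum {ι : Type*} (s : Finset ι) (ω : ℝ) (z : ι → ℂ) (t : ℝ) :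
    sinusoid ω (∑ i ∈ s, z i) t = ∑ i ∈ s, sinusoid ω (z i) t := by
  simp only [sinusoid_eq_im, Finset.sum_mul, Complex.im_sum]

theorem sinusoid_dotProduct {n : Type*} [Fintype n] (ω : ℝ) (c : n → ℝ) (X : n → ℂ) (t : ℝ) :
    sinusoid ω ((fun i => (c i : ℂ)) ⬝ᵥ X) t = c ⬝ᵥ fun i => sinusoid ω (X i) t := by
  simp only [dotProduct, sinusoid_sum, sinusoid_ofReal_mul]

theorem sinusoid_add_half_period {ω : ℝ} (hω : 0 < ω) (z : ℂ) (t : ℝ) :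
    sinusoid ω z (t + Real.pi / ω) = -sinusoid ω z t := by
  have : ω * (t + Real.pi / ω) + z.arg = ω * t + z.arg + Real.pi := by field_simp; ring
  rw [sinusoid, this, Real.sin_add_pi, sinusoid, mul_neg]

section Steady

variable {nK nR nG : Type*} [Fintype nK] [Fintype nR] [Fintype nG]
  [DecidableEq nK] [DecidableEq nR] [DecidableEq nG]

/-- The steady state of the base linear system is a sinusoid in every state. -/
theorem Loop.IsBLSSteadyState.exists_phasor {P : Loop nK nR nG} (hP : P.WellPosed)
    (hst : P.BLSStable) {ω : ℝ} (hω : 0 < ω) (hs : P.NoPoleAt (ω * Complex.I)) {RI : ℂ}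
    {σL : Signals nK nR nG}
    (h : P.IsBLSSteadyState (sinusoid ω RI) (2 * Real.pi / ω) σL) :
    (∃ X : (nK ⊕ nR) ⊕ nG → ℂ, ∀ t, σL.state t = fun i => sinusoid ω (X i) t) ∧
      σL.q = sinusoid ω (P.phasor ω RI) := by
  obtain ⟨X, hX, hXq⟩ := Loop.exists_phasor_state hP hst hs RI
  set A := P.openLoop.feedbackMatrix with hA
  have hstate : ∀ t, σL.state t = fun i => sinusoid ω (X i) t := by
    intro t
    -- The difference from the phasor solution is a periodic solution of the homogeneous Hurwitz
    -- system, hence zero.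
    set Δ : ℝ → (nK ⊕ nR) ⊕ nG → ℝ := fun u => σL.state u - fun i => sinusoid ω (X i) u with hΔ
    have hXd : ∀ u, HasDerivAt (fun u i => sinusoid ω (X i) u)
        (A *ᵥ (fun i => sinusoid ω (X i) u)
          + ((1 + P.openLoop.D)⁻¹ * sinusoid ω RI u) • P.openLoop.B) u := by
      intro u
      rw [hasDerivAt_pi]
      intro i
      refine (hasDerivAt_sinusoid ω (X i) u).congr_deriv ?_
      have hXi := congrFun hX i
      simp only [Pi.smul_apply, smul_eq_mul, Pi.add_apply] at hXi
      rw [hXi, sinusoid_add, Pi.add_apply, Pi.smul_apply, smul_eq_mul]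
      congr 1
      · exact sinusoid_dotProduct ω (A i) X u
      · have : (((1 + P.openLoop.D : ℝ) : ℂ)⁻¹ * RI) * (P.openLoop.B i : ℂ)
            = (((1 + P.openLoop.D)⁻¹ * P.openLoop.B i : ℝ) : ℂ) * RI := by
          push_cast; ring
        rw [this, sinusoid_ofReal_mul]
        ring
    have hd : ∀ u, HasDerivAt Δ (A *ᵥ Δ u) u := by
      intro u
      have h1 := (h.1.hasDerivAt_state hP (Set.notMem_empty u)).sub (hXd u)
      refine h1.congr_deriv ?_
      simp only [hΔ, Matrix.mulVec_sub]
      abel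
    have hc : 0 < 2 * Real.pi / ω := by positivity
    have hflow := eq_exp_mulVec_of_hasDerivAt (a := t) (b := t + 2 * Real.pi / ω) (by linarith)
      (fun u _ => hd u) ((hd _).continuousAt.tendsto.mono_left nhdsWithin_le_nhds)
      ((hd _).continuousAt.tendsto.mono_left nhdsWithin_le_nhds)
    have hper : Δ (t + 2 * Real.pi / ω) = Δ t := by
      have h1 : t + 2 * Real.pi / ω = t + Real.pi / ω + Real.pi / ω := by ring
      have h2 : σL.state (t + 2 * Real.pi / ω) = σL.state t := by
        simp only [Signals.state, h.2.xK t, h.2.xR t, h.2.xG t]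
      simp only [hΔ, h2]
      simp only [h1, sinusoid_add_half_period hω, neg_neg]
    rw [hper, add_sub_cancel_left] at hflow
    exact sub_eq_zero.mp (IsHurwitz.eq_zero_of_exp_mulVec_eq hst hc hflow.symm)
  refine ⟨⟨X, hstate⟩, ?_⟩
  ext t
  rw [h.1.q_eq hP, hstate, ← hXq, sinusoid_add, sinusoid_dotProduct, sinusoid_ofReal_mul]

end Steady

/-! ### Half-wave symmetry and the lattice of reset instants. -/

section Symmetry

variable {nK nR nG : Type*}

/-- The signals shifted by `h` in time, with opposite sign. -/
def Signals.negShift (σ : Signals nK nR nG) (h : ℝ) : Signals nK nR nG where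
  xK t := -σ.xK (t + h)
  xR t := -σ.xR (t + h)
  xG t := -σ.xG (t + h)
  e t := -σ.e (t + h)
  q t := -σ.q (t + h)
  u t := -σ.u (t + h)
  y t := -σ.y (t + h)

theorem Signals.mem_resets_negShift {σ : Signals nK nR nG} {h t : ℝ} :
    t ∈ (σ.negShift h).resets ↔ t + h ∈ σ.resets := by
  simp [Signals.resets, Signals.negShift]

theorem periodic_neg_shift {E : Type*} [Neg E] {f : ℝ → E} {c : ℝ} (hf : Function.Periodic f c)
    (h : ℝ) : Function.Periodic (fun t => -f (t + h)) c := fun t => by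
  simp only [add_right_comm t c h, hf (t + h)]

theorem Signals.IsPeriodic.negShift {σ : Signals nK nR nG} {c : ℝ} (hσ : σ.IsPeriodic c) (h : ℝ) :
    (σ.negShift h).IsPeriodic c where
  xK := periodic_neg_shift hσ.xK h
  xR := periodic_neg_shift hσ.xR h
  xG := periodic_neg_shift hσ.xG h
  e := periodic_neg_shift hσ.e h
  q := periodic_neg_shift hσ.q h
  u := periodic_neg_shift hσ.u h
  y := periodic_neg_shift hσ.y h

theorem tendsto_add_right_nhdsLT (t h : ℝ) :
    Tendsto (fun u : ℝ => u + h) (𝓝[<] t) (𝓝[<] (t + h)) :=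
  tendsto_nhdsWithin_of_tendsto_nhds_of_eventually_within _
    ((continuous_add_const h).tendsto t |>.mono_left nhdsWithin_le_nhds)
    (by filter_upwards [self_mem_nhdsWithin] with u hu using add_lt_add_left hu h)

theorem tendsto_add_right_nhdsGT (t h : ℝ) :
    Tendsto (fun u : ℝ => u + h) (𝓝[>] t) (𝓝[>] (t + h)) :=
  tendsto_nhdsWithin_of_tendsto_nhds_of_eventually_within _
    ((continuous_add_const h).tendsto t |>.mono_left nhdsWithin_le_nhds)
    (by filter_upwards [self_mem_nhdsWithin] with u hu using add_lt_add_left hu h)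

theorem Signals.add_int_mul_mem_resets {σ : Signals nK nR nG} {h : ℝ} (hσ : σ.negShift h = σ)
    {t : ℝ} (ht : t ∈ σ.resets) (p : ℤ) : t + p * h ∈ σ.resets := by
  have hiff : ∀ u, u ∈ σ.resets ↔ u + h ∈ σ.resets := fun u => by
    conv_lhs => rw [← hσ]
    exact Signals.mem_resets_negShift
  induction p with
  | zero => simpa using ht
  | succ p ih =>
    have := (hiff _).mp ih
    convert this using 1
    push_cast; ring
  | pred p ih =>
    refine (hiff _).mpr ?_
    convert ih using 1
    push_cast; ring

/-- Symmetry makes `t` and `t + π/ω` resets, and they already exhaust the two resets allowed in the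
period starting at `t`. Any other reset is translated into that period. -/
theorem resets_eq {ω : ℝ} (hω : 0 < ω) {σ : Signals nK nR nG}
    (hσ : σ.negShift (Real.pi / ω) = σ) (h1 : TwoResetsPerPeriod ω σ) {t : ℝ}
    (ht : t ∈ σ.resets) : σ.resets = {t' : ℝ | ∃ p : ℤ, t' = t + p * (Real.pi / ω)} := by
  have hh : 0 < Real.pi / ω := by positivity
  set h := Real.pi / ω with hdef
  have hc : 2 * Real.pi / ω = 2 * h := by rw [hdef]; ring
  ext t'
  constructor
  · intro ht'
    have hcard := h1 t
    rw [hc] at hcard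
    have hsub : ({t, t + h} : Set ℝ) ⊆ σ.resets ∩ Set.Ico t (t + 2 * h) := by
      rintro u (rfl | rfl)
      · exact ⟨ht, le_rfl, by linarith⟩
      · exact ⟨by simpa using Signals.add_int_mul_mem_resets hσ ht 1, by linarith, by linarith⟩
    have hpair : ({t, t + h} : Set ℝ).ncard = 2 := Set.ncard_pair (by linarith)
    have heq := Set.eq_of_subset_of_ncard_le hsub (by rw [hcard, hpair])
      (Set.finite_of_ncard_ne_zero (by rw [hcard]; norm_num))
    obtain ⟨m, hm, -⟩ := existsUnique_sub_zsmul_mem_Ico (show 0 < 2 * h by linarith) t' t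
    have hmem : t' - m • (2 * h) ∈ ({t, t + h} : Set ℝ) := by
      rw [heq]
      refine ⟨?_, hm⟩
      have := Signals.add_int_mul_mem_resets hσ ht' (-(2 * m))
      convert this using 1
      push_cast; rw [zsmul_eq_mul]; ring
    rw [zsmul_eq_mul] at hmem
    rcases hmem with hmem | hmem
    · exact ⟨2 * m, by push_cast; linarith⟩
    · have hmem : t' - m * (2 * h) = t + h := hmem
      exact ⟨2 * m + 1, by push_cast; linarith⟩
  · rintro ⟨p, rfl⟩
    exact Signals.add_int_mul_mem_resets hσ ht p

variable [Fintype nK] [Fintype nR] [Fintype nG]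

theorem neg_flow {n : Type*} [Fintype n] (A : Matrix n n ℝ) (B x : n → ℝ) (v : ℝ) :
    -(A *ᵥ x + v • B) = A *ᵥ (-x) + (-v) • B := by
  rw [neg_add, Matrix.mulVec_neg, neg_smul]

/-- All flow, output and jump equations are linear and time-invariant, and the reset law `q = 0` is
insensitive to the sign of `q`. -/
theorem Loop.IsResetResponse.negShift {P : Loop nK nR nG} {r : ℝ → ℝ} {σ : Signals nK nR nG}
    (hσ : P.IsResetResponse r σ) {h : ℝ} (hr : ∀ t, r (t + h) = -r t) :
    P.IsResetResponse r (σ.negShift h) := by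
  obtain ⟨H, hfin⟩ := hσ
  refine ⟨⟨?_, ?_, ?_, ?_, ?_, ?_, ?_, ?_, ?_, ?_, ?_⟩, ?_⟩
  · intro t
    simp only [Signals.negShift, H.error, hr]
    ring
  · intro t
    simp only [Signals.negShift, H.outK, dotProduct_neg]
    ring
  · intro t
    simp only [Signals.negShift, H.outR, dotProduct_neg]
    ring
  · intro t
    simp only [Signals.negShift, H.outG, dotProduct_neg]
    ring
  · intro t ht
    refine ((H.flowK (t + h) fun h' => ht (Signals.mem_resets_negShift.mpr h')).comp_add_const
      t h).neg.congr_deriv ?_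
    exact neg_flow _ _ _ _
  · intro t ht
    refine ((H.flowR (t + h) fun h' => ht (Signals.mem_resets_negShift.mpr h')).comp_add_const
      t h).neg.congr_deriv ?_
    exact neg_flow _ _ _ _
  · intro t ht
    refine ((H.flowG (t + h) fun h' => ht (Signals.mem_resets_negShift.mpr h')).comp_add_const
      t h).neg.congr_deriv ?_
    exact neg_flow _ _ _ _
  · intro t ht
    exact ((H.contK (t + h) (Signals.mem_resets_negShift.mp ht)).comp
      (f := fun u => u + h) (continuous_add_const h).continuousAt).neg
  · intro t ht
    exact ((H.contG (t + h) (Signals.mem_resets_negShift.mp ht)).comp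
      (f := fun u => u + h) (continuous_add_const h).continuousAt).neg
  · intro t ht
    exact ((H.leftR (t + h) (Signals.mem_resets_negShift.mp ht)).comp
      (tendsto_add_right_nhdsLT t h)).neg
  · intro t ht
    have := ((H.jumpR (t + h) (Signals.mem_resets_negShift.mp ht)).comp
      (tendsto_add_right_nhdsGT t h)).neg
    rwa [← Matrix.mulVec_neg] at this
  · intro a b
    refine ((hfin (a + h) (b + h)).preimage (f := fun u => u + h)
      (add_left_injective h).injOn).subset ?_
    rintro t ⟨ht, hta, htb⟩
    exact ⟨Signals.mem_resets_negShift.mp ht, add_le_add_left hta h, add_le_add_left htb h⟩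

/-- Half-wave symmetry of the steady state. -/
theorem Loop.IsSteadyState.negShift_eq {P : Loop nK nR nG} {ω : ℝ} (hω : 0 < ω) {RI : ℂ}
    {σ : Signals nK nR nG} (hσ : P.IsSteadyState (sinusoid ω RI) (2 * Real.pi / ω) σ) :
    σ.negShift (Real.pi / ω) = σ :=
  hσ.2 _ (hσ.1.1.negShift (sinusoid_add_half_period hω RI)) (hσ.1.2.negShift _)

end Symmetry

/-! ### The series of impulse responses at a reset instant. -/

section Series

variable {nK nR nG nQ : Type*} [Fintype nQ] [DecidableEq nQ]

theorem summable_seriesTerm {S : MISO nQ nR} (hS : IsHurwitz S.A) {ω : ℝ} (hω : 0 < ω) :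
    Summable (seriesTerm S ω) := by
  have hs := hS.summable_exp_pow (show 0 < Real.pi / ω by positivity)
  have s1 := hs.comp_injective (i := fun k : ℕ => 2 * k + 2) (fun a b h => by simpa using h)
  have s2 := hs.comp_injective (i := fun k : ℕ => 2 * k + 1) (fun a b h => by simpa using h)
  refine (s1.sub s2).congr fun k => ?_
  simp only [Function.comp, ← exp_natCast_smul, seriesTerm]
  congr 3 <;> (push_cast; ring)

variable [Fintype nR]

/-- The alternating series of impulse responses, summed in pairs. -/
theorem hasSum_impulse {S : MISO nQ nR} (hS : IsHurwitz S.A) {ω : ℝ} (hω : 0 < ω) (v : nR → ℝ) :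
    HasSum (fun k : ℕ => (-1 : ℝ) ^ (k + 1) *
      S.impulse (((k + 1 : ℕ) : ℝ) * (Real.pi / ω)) v)
      (S.C ⬝ᵥ ((∑' k : ℕ, seriesTerm S ω k) *ᵥ (S.B *ᵥ v))) := by
  have hs := hS.summable_exp_pow (show 0 < Real.pi / ω by positivity)
  let f : Matrix nQ nQ ℝ →L[ℝ] ℝ := LinearMap.toContinuousLinearMap
    ((dotProductBilin ℝ ℝ S.C).comp ((Matrix.mulVecBilin ℝ ℝ).flip (S.B *ᵥ v)))
  have hf : ∀ M, f M = S.C ⬝ᵥ (M *ᵥ (S.B *ᵥ v)) := fun M => rfl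
  have s1 := (hs.comp_injective (i := fun k : ℕ => 2 * k + 2)
    (fun a b h => by simpa using h)).hasSum
  have s2 := (hs.comp_injective (i := fun k : ℕ => 2 * k + 1)
    (fun a b h => by simpa using h)).hasSum
  have hterm : ∑' k, seriesTerm S ω k
      = (∑' k, ((fun k : ℕ => exp ((Real.pi / ω) • S.A) ^ k) ∘ fun k : ℕ => 2 * k + 2) k)
        - ∑' k, ((fun k : ℕ => exp ((Real.pi / ω) • S.A) ^ k) ∘ fun k : ℕ => 2 * k + 1) k := by
    refine (HasSum.tsum_eq ?_)
    refine (s1.sub s2).congr_fun fun k => ?_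
    simp only [Function.comp, ← exp_natCast_smul, seriesTerm]
    congr 3 <;> (push_cast; ring)
  -- Index `k` carries the power `k + 1`, so even indices give the odd powers with sign -1. The two
  -- halves are swapped accordingly.
  rw [← hf, hterm, map_sub, sub_eq_add_neg, add_comm]
  refine HasSum.even_add_odd ?_ ?_
  · refine (s2.mapL f).neg.congr_fun fun k => ?_
    rw [hf, MISO.impulse, exp_natCast_smul, pow_succ (-1 : ℝ), pow_mul]
    simp
  · refine (s1.mapL f).congr_fun fun k => ?_
    rw [hf, MISO.impulse, exp_natCast_smul, pow_succ (-1 : ℝ), pow_succ (-1 : ℝ), pow_mul]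
    simp

/-- The sum over all resets before `t` is the alternating series. -/
theorem tsum_prior_resets {S : MISO nQ nR} {ω : ℝ} (hω : 0 < ω) {σ : Signals nK nR nG}
    (hσ : σ.negShift (Real.pi / ω) = σ) (h1 : TwoResetsPerPeriod ω σ) {t : ℝ}
    (ht : t ∈ σ.resets) :
    ∑' τ : {τ : ℝ // τ ∈ σ.resets ∧ τ < t}, S.impulse (t - τ) (σ.xR τ)
      = ∑' k : ℕ, (-1 : ℝ) ^ (k + 1) *
        S.impulse (((k + 1 : ℕ) : ℝ) * (Real.pi / ω)) (σ.xR t) := by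
  have hh : 0 < Real.pi / ω := by positivity
  have hres := resets_eq hω hσ h1 ht
  set h := Real.pi / ω with hdef
  -- Half-wave symmetry is the source of the alternating signs.
  have hx : ∀ k : ℕ, σ.xR (t - k * h) = (-1 : ℝ) ^ k • σ.xR t := by
    intro k
    induction k with
    | zero => simp
    | succ k ih =>
      conv_lhs => rw [← hσ]
      simp only [Signals.negShift]
      have e : t - ((k + 1 : ℕ) : ℝ) * h + h = t - k * h := by push_cast; ring
      rw [e, ih, pow_succ]
      simp
  -- Enumerates the earlier resets backwards from `t`; the shift by one excludes `t` itself.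
  let g : ℕ → {τ : ℝ // τ ∈ σ.resets ∧ τ < t} := fun k => ⟨t - ((k + 1 : ℕ) : ℝ) * h, by
    rw [hres]; exact ⟨-((k + 1 : ℕ) : ℤ), by push_cast; ring⟩, by
    have : 0 < ((k + 1 : ℕ) : ℝ) * h := by positivity
    linarith⟩
  have hg : Function.Bijective g := by
    constructor
    · intro a b hab
      have := congrArg Subtype.val hab
      simp only [g, sub_right_inj, mul_eq_mul_right_iff, hh.ne', or_false] at this
      have : a + 1 = b + 1 := by exact_mod_cast this
      omega
    · rintro ⟨τ, hτ, hlt⟩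
      rw [hres] at hτ
      obtain ⟨p, rfl⟩ := hτ
      have hp : (p : ℝ) < 0 := by
        by_contra hc
        have : 0 ≤ (p : ℝ) * h := mul_nonneg (not_lt.mp hc) hh.le
        linarith
      have hp' : p < 0 := by exact_mod_cast hp
      refine ⟨(-p - 1).toNat, Subtype.ext ?_⟩
      have e : (((-p - 1).toNat + 1 : ℕ) : ℤ) = -p := by omega
      have e' : (((-p - 1).toNat + 1 : ℕ) : ℝ) = -(p : ℝ) := by exact_mod_cast e
      simp only [g, e']
      ring
  rw [← (Equiv.ofBijective g hg).tsum_eq]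
  refine tsum_congr fun k => ?_
  simp only [Equiv.ofBijective_apply, g, sub_sub_cancel, hx, MISO.impulse, Matrix.mulVec_smul,
    dotProduct_smul, smul_eq_mul]

variable [Fintype nK] [DecidableEq nK] [DecidableEq nR] [Fintype nG] [DecidableEq nG]

/-- At a reset instant the base linear signal `q_L` equals the summed impulse responses of all
earlier resets. -/
theorem hasSum_impulse_eq_qL {P : Loop nK nR nG} {S : MISO nQ nR}
    {ω : ℝ} (hω : 0 < ω) {RI : ℂ} (hP : P.WellPosed) (hst : P.BLSStable)
    (hpole : P.NoPoleAt (ω * Complex.I)) (hS : P.IsRealizationQδ S)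
    {σ σL : Signals nK nR nG}
    (hσ : P.IsSteadyState (sinusoid ω RI) (2 * Real.pi / ω) σ)
    (hσL : P.IsBLSSteadyState (sinusoid ω RI) (2 * Real.pi / ω) σL)
    (h1 : TwoResetsPerPeriod ω σ) {t : ℝ} (ht : t ∈ σ.resets) :
    HasSum (fun k : ℕ => (-1 : ℝ) ^ (k + 1) *
      S.impulse (((k + 1 : ℕ) : ℝ) * (Real.pi / ω)) (σ.xR t)) (σL.q t) := by
  have hh : 0 < Real.pi / ω := by positivity
  have hsym := hσ.negShift_eq hω
  obtain ⟨⟨X, hX⟩, -⟩ := hσL.exists_phasor hP hst hω hpole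
  have hres := resets_eq hω hsym h1 ht
  set h := Real.pi / ω with hdef
  set A := P.openLoop.feedbackMatrix with hA
  set Δ : ℝ → (nK ⊕ nR) ⊕ nG → ℝ := fun u => σ.state u - σL.state u with hΔ
  have hprev : t - h ∈ σ.resets := by
    rw [hres]; exact ⟨-1, by push_cast; ring⟩
  have hLcont : ∀ u, ContinuousAt σL.state u := fun u =>
    (hσL.1.hasDerivAt_state hP (Set.notMem_empty u)).continuousAt
  -- The reference cancels in `Δ`, and no reset lies strictly between `t - h` and `t`. The right
  -- limit at `t - h` includes the jump there.
  have hflow := eq_exp_mulVec_of_hasDerivAt (A := A) (x := Δ) (a := t - h) (b := t)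
    (by linarith)
    (fun u hu => by
      have hu' : u ∉ σ.resets := by
        rw [hres]
        rintro ⟨p, rfl⟩
        have e1 : (-1 : ℝ) < p := by
          by_contra hc
          have : (p : ℝ) * h ≤ (-1) * h := mul_le_mul_of_nonneg_right (not_lt.mp hc) hh.le
          linarith [hu.1]
        have e2 : (p : ℝ) < 0 := by
          by_contra hc
          have : 0 ≤ (p : ℝ) * h := mul_nonneg (not_lt.mp hc) hh.le
          linarith [hu.2]
        have e1' : -1 < p := by exact_mod_cast e1
        have e2' : p < 0 := by exact_mod_cast e2
        omega
      refine ((hσ.1.1.1.hasDerivAt_state hP hu').sub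
        (hσL.1.hasDerivAt_state hP (Set.notMem_empty u))).congr_deriv ?_
      simp only [hΔ, Matrix.mulVec_sub]
      abel)
    ((hσ.1.1.1.tendsto_right hprev).sub ((hLcont _).tendsto.mono_left nhdsWithin_le_nhds))
    ((hσ.1.1.1.tendsto_left ht).sub ((hLcont _).tendsto.mono_left nhdsWithin_le_nhds))
  have hxR : σ.xR (t - h) = -σ.xR t := by
    conv_lhs => rw [← hsym]
    simp [Signals.negShift]
  have hst1 : σ.state (t - h) = -σ.state t := by
    conv_lhs => rw [← hsym]
    ext i; rcases i with (i | i) | i <;> simp [Signals.negShift, Signals.state]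
  have hst2 : σL.state (t - h) = -σL.state t := by
    have e : t = t - h + h := by ring
    rw [hX (t - h), hX t]
    ext i
    rw [Pi.neg_apply]
    conv_rhs => rw [e, sinusoid_add_half_period hω, neg_neg]
  set b : (nK ⊕ nR) ⊕ nG → ℝ := stateR ((P.R.Aρ - 1) *ᵥ σ.xR t) with hb
  have hb' : (stateR ((P.R.Aρ - 1) *ᵥ (-σ.xR t)) : (nK ⊕ nR) ⊕ nG → ℝ) = -b := by
    rw [Matrix.mulVec_neg]
    ext i; rcases i with (i | i) | i <;> simp [hb, stateR]
  have hfix : Δ t = -(exp (h • A) *ᵥ (Δ t + b)) := by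
    rw [hst1, hst2, hxR, hb', sub_sub_cancel] at hflow
    rw [← Matrix.mulVec_neg]
    refine hflow.trans ?_
    congr 1
    simp only [hΔ]
    abel
  have hs := (IsHurwitz.hasSum_alternating hst hh hfix).mapL
    (LinearMap.toContinuousLinearMap (dotProductBilin ℝ ℝ P.rowQ))
  -- Here `q = 0` at a reset enters; the feedthrough from the reference is common to both outputs
  -- and cancels.
  have hq : -(P.rowQ ⬝ᵥ Δ t) = σL.q t := by
    have e1 := hσ.1.1.1.q_eq hP t
    have e2 := hσL.1.q_eq hP t
    have e3 : σ.q t = 0 := ht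
    simp only [hΔ, dotProduct_sub]
    linarith
  rw [← hq]
  refine hs.neg.congr_fun fun k => ?_
  have e := Loop.rowQ_exp_eq hP hS (σ.xR t) (((k + 1 : ℕ) : ℝ) * h)
  rw [eq_neg_iff_add_eq_zero, add_comm, ← eq_neg_iff_add_eq_zero] at e
  rw [e]
  simp [hb]

end Series

/-! ### The phase of the reset instants. -/

/-- The angle `arcsin a` has the same sine as `θ` and the opposite cosine, so the cosine of the sum
is `-cos² θ - sin² θ = -1`. -/
theorem exists_add_arcsin_eq {θ a : ℝ} (hsin : Real.sin θ = a) (hcos : Real.cos θ < 0) :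
    ∃ k : ℤ, θ + Real.arcsin a = Real.pi + 2 * Real.pi * k := by
  have h1 : -1 ≤ a := hsin ▸ Real.neg_one_le_sin θ
  have h2 : a ≤ 1 := hsin ▸ Real.sin_le_one θ
  have hc : Real.cos (Real.arcsin a) = -Real.cos θ := by
    rw [Real.cos_arcsin, ← hsin, ← Real.abs_cos_eq_sqrt_one_sub_sin_sq, abs_of_neg hcos]
  have h : Real.cos (θ + Real.arcsin a) = -1 := by
    rw [Real.cos_add, Real.sin_arcsin h1 h2, hc, hsin]
    have := Real.sin_sq_add_cos_sq θ
    rw [hsin] at this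
    linarith
  obtain ⟨k, hk⟩ := Real.cos_eq_neg_one_iff.mp h
  exact ⟨k, by rw [← hk]; ring⟩

theorem hasDerivAt_sin_affine (ω φ t : ℝ) :
    HasDerivAt (fun u => Real.sin (ω * u + φ)) (ω * Real.cos (ω * t + φ)) t := by
  have h : HasDerivAt (fun u : ℝ => ω * u + φ) ω t := by
    simpa using ((hasDerivAt_id t).const_mul ω).add_const φ
  simpa [mul_comm] using h.sin

theorem deriv_sinusoid (ω : ℝ) (z : ℂ) (t : ℝ) :
    deriv (sinusoid ω z) t = ‖z‖ * (ω * Real.cos (ω * t + z.arg)) :=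
  ((hasDerivAt_sin_affine ω z.arg t).const_mul ‖z‖).deriv

theorem xR_add_int_mul {nK nR nG : Type*} {σ : Signals nK nR nG} {c : ℝ} (h : σ.IsPeriodic c)
    (t : ℝ) (k : ℤ) : σ.xR (t + k * c) = σ.xR t :=
  (h.xR.int_mul k) t

section Main

variable {nK nR nG nQ : Type*} [Fintype nK] [DecidableEq nK] [Fintype nR] [DecidableEq nR]
  [Fintype nG] [DecidableEq nG] [Fintype nQ] [DecidableEq nQ]

/-- The paired series and the sum over earlier resets both equal `q_L(t)`. As `|q_L|` never exceeds
`|Z|`, the peak assumption gives both `|Z| > 0` and the strict bound. -/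
theorem sin_eq_phaseArg {P : Loop nK nR nG} {S : MISO nQ nR}
    {ω : ℝ} (hω : 0 < ω) {RI : ℂ} (hP : P.WellPosed) (hst : P.BLSStable)
    (hpole : P.NoPoleAt (ω * Complex.I)) (hS : P.IsRealizationQδ S) (hSst : IsHurwitz S.A)
    {σ σL : Signals nK nR nG}
    (hσ : P.IsSteadyState (sinusoid ω RI) (2 * Real.pi / ω) σ)
    (hσL : P.IsBLSSteadyState (sinusoid ω RI) (2 * Real.pi / ω) σL)
    (h1 : TwoResetsPerPeriod ω σ) (h3 : PriorResetsBelowPeak S σ σL) {t : ℝ}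
    (ht : t ∈ σ.resets) :
    0 < ‖P.phasor ω RI‖ ∧ |P.phaseArg S ω RI (σ.xR t)| < 1 ∧
      Real.sin (ω * t + (P.phasor ω RI).arg) = P.phaseArg S ω RI (σ.xR t) := by
  have hqL := (hσL.exists_phasor hP hst hω hpole).2
  have hsumL := hasSum_impulse_eq_qL hω hP hst hpole hS hσ hσL h1 ht
  have hsum := (hasSum_impulse hSst hω (σ.xR t)).unique hsumL
  obtain ⟨t', ht'⟩ := h3 t ht
  rw [tsum_prior_resets hω (hσ.negShift_eq hω) h1 ht, hsumL.tsum_eq] at ht'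
  have hle : |σL.q t'| ≤ ‖P.phasor ω RI‖ := by
    rw [hqL, sinusoid, abs_mul, abs_norm]
    exact mul_le_of_le_one_right (norm_nonneg _) (Real.abs_sin_le_one _)
  have hlt := ht'.trans_le hle
  have hpos : 0 < ‖P.phasor ω RI‖ := (abs_nonneg _).trans_lt hlt
  have harg : P.phaseArg S ω RI (σ.xR t) = σL.q t * ‖P.phasor ω RI‖⁻¹ := by
    rw [Loop.phaseArg, hsum]
  refine ⟨hpos, ?_, ?_⟩
  · rw [harg, abs_mul, abs_inv, abs_norm, ← div_eq_mul_inv, div_lt_one hpos]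
    exact hlt
  · rw [harg, hqL, sinusoid]
    field_simp

/-- The direction assumption transfers the sign to the derivative of `q_L`, which is `|Z| ω cos(ωt +
∠Z)` with positive prefactor. -/
theorem isDescendingReset_iff {P : Loop nK nR nG}
    {ω : ℝ} (hω : 0 < ω) {RI : ℂ} (hP : P.WellPosed) (hst : P.BLSStable)
    (hpole : P.NoPoleAt (ω * Complex.I)) {σ σL : Signals nK nR nG}
    (hσL : P.IsBLSSteadyState (sinusoid ω RI) (2 * Real.pi / ω) σL)
    (h2 : SameCrossingDirection σ σL) (hpos : 0 < ‖P.phasor ω RI‖) {t : ℝ} (ht : t ∈ σ.resets) :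
    σ.IsDescendingReset t ↔ Real.cos (ω * t + (P.phasor ω RI).arg) < 0 := by
  have hqL := (hσL.exists_phasor hP hst hω hpole).2
  have h := h2 t ht
  rw [Signals.IsDescendingReset, and_iff_right ht, ← sign_eq_neg_one_iff, h, sign_eq_neg_one_iff,
    hqL, deriv_sinusoid, mul_neg_iff, mul_neg_iff]
  simp [hpos, hω, hω.not_gt, (norm_nonneg (P.phasor ω RI)).not_gt]

end Main

end ResetLoop

end

theorem mainTheorem3 {nK nR nG nQ : Type*}
    [Fintype nK] [DecidableEq nK] [Fintype nR] [DecidableEq nR]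
    [Fintype nG] [DecidableEq nG] [Fintype nQ] [DecidableEq nQ]
    (P : ResetLoop.Loop nK nR nG) (S : ResetLoop.MISO nQ nR)
    (ω : ℝ) (hω : 0 < ω) (RI : ℂ)
    (hwp : P.WellPosed) (hBLS : P.BLSStable) (hpole : P.NoPoleAt (ω * Complex.I))
    (hS : P.IsRealizationQδ S) (hSstable : ResetLoop.IsHurwitz S.A)
    (σ σL : ResetLoop.Signals nK nR nG)
    (hσ : P.IsSteadyState (ResetLoop.sinusoid ω RI) (2 * Real.pi / ω) σ)
    (hσL : P.IsBLSSteadyState (ResetLoop.sinusoid ω RI) (2 * Real.pi / ω) σL)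
    (h1 : ResetLoop.TwoResetsPerPeriod ω σ)
    (h2 : ResetLoop.SameCrossingDirection σ σL)
    (h3 : ResetLoop.PriorResetsBelowPeak S σ σL) :
    Summable (ResetLoop.seriesTerm S ω) ∧
    (∃! t : ℝ, σ.IsDescendingReset t ∧
      ω * t + (P.phasor ω RI).arg + P.Φ S ω RI (σ.xR t) = Real.pi) ∧
    ∀ t : ℝ, σ.IsDescendingReset t →
      0 < ‖P.phasor ω RI‖ ∧ |P.phaseArg S ω RI (σ.xR t)| < 1 ∧
      (∃ k : ℤ, ω * t + (P.phasor ω RI).arg + P.Φ S ω RI (σ.xR t)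
        = Real.pi + 2 * Real.pi * k) ∧
      σ.resets = {t' : ℝ | P.Qstar S ω RI (σ.xR t) t' = 0} ∧
      σ.resets = {t' : ℝ | ∃ p : ℤ, t' = t + p * Real.pi / ω} ∧
      (∀ t' : ℝ, σ.IsDescendingReset t' ↔
        P.Qstar S ω RI (σ.xR t) t' = 0 ∧ deriv (P.Qstar S ω RI (σ.xR t)) t' < 0) ∧
      (P.Φ S ω RI (σ.xR t) = 0 →
        ∀ t' : ℝ, σ.IsDescendingReset t' ↔ σL.q t' = 0 ∧ deriv σL.q t' < 0) := by
  open ResetLoop in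
  have hsym := hσ.negShift_eq hω
  have hcore := fun {t : ℝ} (ht : t ∈ σ.resets) =>
    sin_eq_phaseArg hω hwp hBLS hpole hS hSstable hσ hσL h1 h3 ht
  have hdesc := fun {t : ℝ} (ht : t ∈ σ.resets) =>
    isDescendingReset_iff hω hwp hBLS hpole hσL h2 (hcore ht).1 ht
  have hqL := (hσL.exists_phasor hwp hBLS hω hpole).2
  set Z := P.phasor ω RI with hZ
  have hphase : ∀ {t : ℝ}, σ.IsDescendingReset t →
      ∃ k : ℤ, ω * t + Z.arg + P.Φ S ω RI (σ.xR t) = Real.pi + 2 * Real.pi * k := fun ht =>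
    exists_add_arcsin_eq (hcore ht.1).2.2 ((hdesc ht.1).mp ht)
  have hshift : ∀ (t : ℝ) (p : ℤ), ω * (t + p * (Real.pi / ω)) + Z.arg
      = ω * t + Z.arg + p * Real.pi := fun t p => by field_simp; ring
  have hcos : ∀ (t : ℝ) (p : ℤ), Real.cos (ω * (t + p * (Real.pi / ω)) + Z.arg)
      = Real.cos (ω * t + Z.arg) * Real.cos (p * Real.pi) := fun t p => by
    rw [hshift, Real.cos_add, Real.sin_int_mul_pi]; ring
  have hdesc' : ∀ {t : ℝ}, σ.IsDescendingReset t → ∀ p : ℤ,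
      (σ.IsDescendingReset (t + p * (Real.pi / ω)) ↔ 0 < Real.cos (p * Real.pi)) := by
    intro t ht p
    have h := (hdesc ht.1).mp ht
    rw [hdesc (Signals.add_int_mul_mem_resets hsym ht.1 p), hcos]
    exact ⟨fun h' => pos_of_mul_neg_right h' h.le, fun h' => mul_neg_of_neg_of_pos h h'⟩
  have hperiod : ∀ (t : ℝ) (k : ℤ), σ.xR (t + (2 * k : ℤ) * (Real.pi / ω)) = σ.xR t := by
    intro t k
    rw [← xR_add_int_mul hσ.1.2 t k]
    congr 1; push_cast; ring
  refine ⟨summable_seriesTerm hSstable hω, ?_, ?_⟩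
  · obtain ⟨t₁, ht₁⟩ : (σ.resets ∩ Set.Ico 0 (0 + 2 * Real.pi / ω)).Nonempty :=
      Set.nonempty_of_ncard_ne_zero (by rw [h1 0]; norm_num)
    obtain ⟨t₂, ht₂⟩ : ∃ t, σ.IsDescendingReset t := by
      rcases lt_or_ge (Real.cos (ω * t₁ + Z.arg)) 0 with h | h
      · exact ⟨t₁, (hdesc ht₁.1).mpr h⟩
      · refine ⟨t₁ + (1 : ℤ) * (Real.pi / ω),
          (hdesc (Signals.add_int_mul_mem_resets hsym ht₁.1 1)).mpr ?_⟩
        -- The strict bound on the sine excludes a tangential reset, so of two consecutive resets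
        -- one is descending.
        have hne : Real.cos (ω * t₁ + Z.arg) ≠ 0 := fun h0 => by
          have ha := (hcore ht₁.1).2.1
          have hs := Real.sin_sq_add_cos_sq (ω * t₁ + Z.arg)
          rw [← (hcore ht₁.1).2.2, ← sq_lt_one_iff_abs_lt_one] at ha
          rw [h0] at hs
          linarith
        rw [hcos]
        simpa using lt_of_le_of_ne h hne.symm
    obtain ⟨k, hk⟩ := hphase ht₂
    -- Moving by `-k` full periods keeps the reset descending and leaves `xR`, hence `Φ`, unchanged,
    -- while the phase drops by `2πk` to exactly `π`.
    refine ⟨t₂ + (2 * (-k) : ℤ) * (Real.pi / ω), ⟨?_, ?_⟩, ?_⟩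
    · rw [hdesc' ht₂]
      have : ((2 * (-k) : ℤ) : ℝ) * Real.pi = (-k : ℤ) * (2 * Real.pi) := by push_cast; ring
      rw [this, Real.cos_int_mul_two_pi]
      exact one_pos
    · rw [hshift, hperiod]
      push_cast
      linarith
    · rintro t ⟨ht, hteq⟩
      have hmem := ht.1
      rw [resets_eq hω hsym h1 ht₂.1] at hmem
      obtain ⟨p, rfl⟩ := hmem
      have hp := (hdesc' ht₂ p).mp ht
      have hp1 : Real.cos (p * Real.pi) = 1 := by
        rcases Real.sin_eq_zero_iff_cos_eq.mp (Real.sin_int_mul_pi p) with h | h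
        · exact h
        · rw [h] at hp; norm_num at hp
      obtain ⟨m, hm⟩ := (Real.cos_eq_one_iff _).mp hp1
      have hpm : p = 2 * m := by
        have : (p : ℝ) = 2 * m := mul_right_cancel₀ Real.pi_ne_zero (by linarith)
        exact_mod_cast this
      subst hpm
      rw [hshift, hperiod] at hteq
      have hmk : (((2 * m : ℤ) : ℝ)) = ((2 * (-k) : ℤ) : ℝ) := by
        refine mul_right_cancel₀ Real.pi_ne_zero ?_
        push_cast at hteq ⊢
        linarith
      rw [hmk]
  · intro t ht
    obtain ⟨k, hk⟩ := hphase ht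
    have hres := resets_eq hω hsym h1 ht.1
    -- The phase condition at `t` turns `Q*` into `-sin(ω(t' - t))`, from which its zeros and their
    -- directions are read off.
    have hang : ∀ t', ω * t' + P.phaseQstar S ω RI (σ.xR t)
        = ω * (t' - t) + Real.pi + k * (2 * Real.pi) := by
      intro t'
      rw [Loop.phaseQstar, ← hZ]
      linear_combination hk
    have hQ : ∀ t', P.Qstar S ω RI (σ.xR t) t' = -Real.sin (ω * (t' - t)) := by
      intro t'
      rw [Loop.Qstar, hang, Real.sin_add_int_mul_two_pi, Real.sin_add_pi]
    have hQd : ∀ t', deriv (P.Qstar S ω RI (σ.xR t)) t' = -(ω * Real.cos (ω * (t' - t))) := by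
      intro t'
      have h := (hasDerivAt_sin_affine ω (P.phaseQstar S ω RI (σ.xR t)) t').deriv
      rw [hang, Real.cos_add_int_mul_two_pi, Real.cos_add_pi, mul_neg] at h
      exact h
    have hzero : ∀ t', P.Qstar S ω RI (σ.xR t) t' = 0 ↔ ∃ p : ℤ, t' = t + p * (Real.pi / ω) := by
      intro t'
      rw [hQ, neg_eq_zero, Real.sin_eq_zero_iff]
      refine exists_congr fun p => ?_
      rw [← mul_div_assoc, ← sub_eq_iff_eq_add', eq_div_iff hω.ne', mul_comm (t' - t), eq_comm]
    have hiff : ∀ t', σ.IsDescendingReset t' ↔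
        P.Qstar S ω RI (σ.xR t) t' = 0 ∧ deriv (P.Qstar S ω RI (σ.xR t)) t' < 0 := by
      have hd : ∀ p : ℤ, deriv (P.Qstar S ω RI (σ.xR t)) (t + p * (Real.pi / ω)) < 0 ↔
          0 < Real.cos (p * Real.pi) := by
        intro p
        have e : ω * (t + p * (Real.pi / ω) - t) = p * Real.pi := by field_simp; ring
        rw [hQd, e, neg_lt_zero, mul_pos_iff_of_pos_left hω]
      intro t'
      constructor
      · intro ht'
        have hmem := ht'.1
        rw [hres] at hmem
        obtain ⟨p, rfl⟩ := hmem
        exact ⟨(hzero _).mpr ⟨p, rfl⟩, (hd p).mpr ((hdesc' ht p).mp ht')⟩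
      · rintro ⟨h0, hneg⟩
        obtain ⟨p, rfl⟩ := (hzero _).mp h0
        exact (hdesc' ht p).mpr ((hd p).mp hneg)
    refine ⟨(hcore ht.1).1, (hcore ht.1).2.1, ⟨k, hk⟩, ?_, ?_, hiff, ?_⟩
    · rw [hres]
      ext t'
      exact (hzero t').symm
    · rw [hres]
      simp only [mul_div_assoc]
    · intro hΦ t'
      -- Without phase shift `q_L` is a positive multiple of `Q*`, so the two have the same
      -- descending zeros.
      have hq : σL.q = fun u => ‖Z‖ * P.Qstar S ω RI (σ.xR t) u := by
        rw [hqL]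
        ext u
        rw [Loop.Qstar, Loop.phaseQstar, hΦ, add_zero, sinusoid]
      have hpos := (hcore ht.1).1
      rw [hiff, hq, deriv_const_mul_field, mul_eq_zero_iff_left hpos.ne',
        mul_neg_iff]
      simp [hpos, hpos.not_gt]
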